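/- Notation. $\Phi$ is the standard normal cumulative distribution function. For a map $T$ between metric spaces, $\mathrm{Lip}(T,x)=\lim_{\varepsilon\to0^+}\mathrm{Lip}(T|_{B(x,\varepsilon)})\in[0,\infty]$ is its local Lipschitz constant at $x$. For a probability measure on $\mathbb{R}$ with cumulative distribution function $F$, the quantile function is $F^{-1}(s)=\inf\{t\in\mathbb{R}:F(t)\ge s\}$, $0<s<1$. For $f:\mathbb{R}^n\to\mathbb{R}$ differentiable and $1\le s\le\infty$, \[ \mathrm{Lip}_s(f)=\sup_{x\in\mathbb{R}^n}|\nabla f(x)|_s,\qquad \mathrm{Lip}_s^\sharp(f)=\Big(\sum_{i=1}^n\sup_{x\in\mathbb{R}^n}\Big|\frac{\partial f}{\partial x_i}(x)\Big|^s\Big)^{1/s} \] (with a maximum over $i$ if $s=\infty$); these take values in $[0,\infty]$, and we use $t/0=\infty$, $t/\infty=0$ for $0<t<\infty$, and $e^{-\infty}=0$. $\mathbb{M}Y$ denotes a median of $Y$. Theorem (Weibull type tails). For every $0<q<1$ there are constants $c_q,C_q>0$, depending only on $q$, such that the following holds. Let $n\ge1$ and let $\mu_1,\dots,\mu_n$ be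 probability measures on $\mathbb{R}$, with cumulative distribution functions $F_i$ and quantile functions $F_i^{-1}$, such that for all $1\le i\le n$ and all $s\in\mathbb{R}$, \[ \mathrm{Lip}(F_i^{-1}\circ\Phi,s)\le(1+|s|)^{-1+2/q}. \] Let $f:\mathbb{R}^n\to\mathbb{R}$ be differentiable, let $X_1,\dots,X_n$ be independent random variables, $X_i$ with distribution $\mu_i$, and let $X=(X_1,\dots,X_n)$. Then for all $t>0$, \[ \mathbb{P}\{|f(X)-\mathbb{M}f(X)|>t\}\le2\exp\Big(-c_q\min\Big\{\Big(\frac{t}{\mathrm{Lip}_2^\sharp(f)}\Big)^2,\Big(\frac{t}{\mathrm{Lip}_\infty^\sharp(f)}\Big)^q\Big\}\Big) \] and \[ \mathbb{P}\Big\{|f(X)-\mathbb{M}f(X)|>C_q\Big(\log\Big(e+\frac{n}{t^{-2+4/q}}\Big)\Big)^{1/q-1/2}\big(t\,\mathrm{Lip}_2(f)+t^{2/q}\,\mathrm{Lip}_\infty(f)\big)\Big\}\le2\exp(-t^2/2). \] -/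

import Mathlib

open MeasureTheory ProbabilityTheory Filter Topology
open scoped ENNReal

noncomputable section

/-- The Lipschitz constant, in `[0, ∞]`, of the restriction of `T` to the set `A`. -/
def lipConstOn {α β : Type*} [MetricSpace α] [MetricSpace β] (T : α → β) (A : Set α) : ℝ≥0∞ :=
  ⨆ (x ∈ A) (y ∈ A), edist (T x) (T y) / edist x y

/-- The local Lipschitz constant `Lip(T, x)`: the limit as `ε → 0⁺` of the Lipschitz constant of
`T` on the ball `B(x, ε)`. By monotonicity in `ε` this limit is the infimum over `ε > 0`
(see `tendsto_lipConstOn_ball`). -/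
def localLip {α β : Type*} [MetricSpace α] [MetricSpace β] (T : α → β) (x : α) : ℝ≥0∞ :=
  ⨅ (ε : ℝ) (_ : 0 < ε), lipConstOn T (Metric.ball x ε)

theorem lipConstOn_mono {α β : Type*} [MetricSpace α] [MetricSpace β] (T : α → β)
    {A B : Set α} (h : A ⊆ B) : lipConstOn T A ≤ lipConstOn T B :=
  iSup₂_le fun x hx => iSup₂_le fun y hy =>
    le_iSup₂_of_le x (h hx) (le_iSup₂_of_le y (h hy) le_rfl)

theorem tendsto_lipConstOn_ball {α β : Type*} [MetricSpace α] [MetricSpace β]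
    (T : α → β) (x : α) :
    Tendsto (fun ε : ℝ => lipConstOn T (Metric.ball x ε)) (𝓝[>] 0) (𝓝 (localLip T x)) := by
  have hm : Monotone (fun ε : ℝ => lipConstOn T (Metric.ball x ε)) :=
    fun a b hab => lipConstOn_mono T (Metric.ball_subset_ball hab)
  have h := hm.tendsto_nhdsGT (0 : ℝ)
  rwa [sInf_image] at h

/-- The quantile function (generalized inverse of the CDF) of a probability measure on `ℝ`:
`F⁻¹(s) = inf {t | F t ≥ s}`, meaningful for `s ∈ (0, 1)`. -/
def quantile (μ : Measure ℝ) (s : ℝ) : ℝ :=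
  sInf {t : ℝ | s ≤ cdf μ t}

/-- The standard normal cumulative distribution function `Φ`. -/
def stdNormalCDF (x : ℝ) : ℝ := cdf (gaussianReal 0 1) x

/-- `m` is a median of the real random variable `Y`. -/
def IsMedian {Ω : Type*} [MeasurableSpace Ω] (P : Measure Ω) (Y : Ω → ℝ) (m : ℝ) : Prop :=
  1 / 2 ≤ P {ω | Y ω ≤ m} ∧ 1 / 2 ≤ P {ω | m ≤ Y ω}

/-- The partial derivative `∂f/∂xᵢ` at `x`. -/
def partialDeriv {n : ℕ} (f : (Fin n → ℝ) → ℝ) (i : Fin n) (x : Fin n → ℝ) : ℝ :=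
  fderiv ℝ f x (Pi.single i 1)

/-- The `ℓ_s^n` norm, `1 ≤ s ≤ ∞`, of a vector with entries in `[0, ∞]`. -/
def ellNorm {n : ℕ} (s : ℝ≥0∞) (a : Fin n → ℝ≥0∞) : ℝ≥0∞ :=
  if s = ∞ then ⨆ i, a i else (∑ i, a i ^ s.toReal) ^ (1 / s.toReal)

/-- `Lip_s(f) = sup_x |∇f(x)|_s`, in `[0, ∞]`, for `f` differentiable and `1 ≤ s ≤ ∞`. -/
def gradLip {n : ℕ} (s : ℝ≥0∞) (f : (Fin n → ℝ) → ℝ) : ℝ≥0∞ :=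
  ⨆ x, ellNorm s (fun i => ENNReal.ofReal |partialDeriv f i x|)

/-- `Lip_s^♯(f) = (∑ᵢ sup_x |∂f/∂xᵢ(x)|^s)^{1/s}` (a maximum if `s = ∞`), in `[0, ∞]`, for `f`
differentiable and `1 ≤ s ≤ ∞`. -/
def gradLipSharp {n : ℕ} (s : ℝ≥0∞) (f : (Fin n → ℝ) → ℝ) : ℝ≥0∞ :=
  ellNorm s (fun i => ⨆ x, ENNReal.ofReal |partialDeriv f i x|)

end

/-! The monotone maps T_i = F_i⁻¹ ∘ Φ push the standard Gaussian law to μ_i, so f(X) has the law of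
g(G) with g(x) = f(T_1 x_1, ..., T_n x_n). With r = 2/q - 1 ≥ 1, the local Lipschitz hypothesis
gives |∂_i g(x)|² ≤ |∂_i f|² (1 + |x_i|)^(2r) wherever T_i is differentiable at x_i for all i, hence
almost everywhere. It remains to bound high moments of g(G) - g(G') for an independent copy G'.

Rotating G into G' by small angles and using rotation invariance gives the Maurey-Pisier inequality
E(g(G) - g(G'))^(2k) ≤ E(96 k |∇g(G)|²)^k (`lintegral_sub_pow_comp_le`). The right side is a k-th
moment of a sum of variables with Weibull tails. It is controlled by an exponential moment of a
subadditive function of the sum, which factorizes over coordinates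
(`lintegral_sum_pow_le_of_weibull`). For the sharp norms, the coordinates are weighted by the
suprema of the partial derivatives (`lintegral_gradient_pow_le_of_sharp`). For the ordinary norms,
each weight (1 + |x_i|)^(2r) is cut at a logarithmic level: the bounded part is charged to Lip_2 and
the excess to Lip_∞ (`lintegral_gradient_pow_le`).

Chebyshev's inequality at order 2k gives probability at most e^(-k), and comparison with an
independent copy turns this into deviation from a median at the cost of a factor 2
(`measure_abs_sub_median_gt_le`). Then k is taken comparable to the desired exponent. -/

/-! ### Transport of the Gaussian by quantile functions -/

lemma continuous_cdf_of_nullSingletonClass (μ : Measure ℝ) [IsProbabilityMeasure μ] [NullSingletonClass μ] :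
    Continuous (cdf μ) := by
  rw [continuous_iff_continuousAt]
  intro x
  have h := StieltjesFunction.measure_singleton (cdf μ) x
  rw [measure_cdf, measure_singleton] at h
  have h1 : cdf μ x ≤ Function.leftLim (cdf μ) x := by
    have := ENNReal.ofReal_eq_zero.1 h.symm
    linarith
  exact ((monotone_cdf μ).continuousAt_iff_leftLim_eq_rightLim).2
    (le_antisymm ((monotone_cdf μ).leftLim_le_rightLim le_rfl)
      (by rw [StieltjesFunction.rightLim_eq]; exact h1))

lemma nullSingletonClass_stdNormal : NullSingletonClass (gaussianReal 0 1) := nullSingletonClass_gaussianReal one_ne_zero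

lemma stdNormalCDF_strictMono : StrictMono stdNormalCDF := by
  intro a b hab
  have h := StieltjesFunction.measure_Ioc (cdf (gaussianReal 0 1)) a b
  rw [measure_cdf] at h
  have h0 : gaussianReal 0 1 (Set.Ioc a b) ≠ 0 := fun h0 => by
    have := gaussianReal_absolutelyContinuous' 0 one_ne_zero h0
    rw [Real.volume_Ioc, ENNReal.ofReal_eq_zero] at this
    linarith
  rw [h, ENNReal.ofReal_ne_zero_iff] at h0
  unfold stdNormalCDF
  linarith

lemma stdNormalCDF_continuous : Continuous stdNormalCDF :=
  have := nullSingletonClass_stdNormal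
  continuous_cdf_of_nullSingletonClass _

lemma stdNormalCDF_pos (x : ℝ) : 0 < stdNormalCDF x :=
  (cdf_nonneg _ (x - 1)).trans_lt (stdNormalCDF_strictMono (by linarith : x - 1 < x))

lemma stdNormalCDF_lt_one (x : ℝ) : stdNormalCDF x < 1 :=
  (stdNormalCDF_strictMono (by linarith : x < x + 1)).trans_le (cdf_le_one _ (x + 1))

/-- Right continuity of the distribution function makes the infimum attained; 0 < s < 1 makes the
set bounded below and nonempty, so that `sInf` is not a default value. -/
lemma quantile_le_iff (μ : Measure ℝ) {s : ℝ} (h0 : 0 < s) (h1 : s < 1) (t : ℝ) :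
    quantile μ s ≤ t ↔ s ≤ cdf μ t := by
  have hbdd : BddBelow {t : ℝ | s ≤ cdf μ t} := by
    obtain ⟨a, ha⟩ := ((tendsto_cdf_atBot μ).eventually (gt_mem_nhds h0)).exists
    exact ⟨a, fun t ht => le_of_not_gt fun hlt =>
      (ha.trans_le ht).not_ge (monotone_cdf μ hlt.le)⟩
  have hne : {t : ℝ | s ≤ cdf μ t}.Nonempty := by
    obtain ⟨a, ha⟩ := ((tendsto_cdf_atTop μ).eventually (lt_mem_nhds h1)).exists
    exact ⟨a, le_of_lt ha⟩
  refine ⟨fun h => ?_, fun h => csInf_le hbdd h⟩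
  have hr : Tendsto (cdf μ) (𝓝[>] t) (𝓝 (cdf μ t)) :=
    ((cdf μ).right_continuous t).tendsto.mono_left (nhdsWithin_mono _ Set.Ioi_subset_Ici_self)
  refine ge_of_tendsto hr (eventually_nhdsWithin_of_forall fun u hu => ?_)
  obtain ⟨v, hv, hvu⟩ := exists_lt_of_csInf_lt hne (lt_of_le_of_lt h hu)
  exact le_trans hv (monotone_cdf μ hvu.le)

lemma normalQuantile_monotone (μ : Measure ℝ) : Monotone (quantile μ ∘ stdNormalCDF) := by
  intro a b hab
  refine (quantile_le_iff μ (stdNormalCDF_pos a) (stdNormalCDF_lt_one a) _).2 ?_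
  exact (stdNormalCDF_strictMono.monotone hab).trans
    ((quantile_le_iff μ (stdNormalCDF_pos b) (stdNormalCDF_lt_one b) _).1 le_rfl)

lemma measurable_normalQuantile (μ : Measure ℝ) : Measurable (quantile μ ∘ stdNormalCDF) :=
  (normalQuantile_monotone μ).measurable

lemma gaussian_setOf_stdNormalCDF_le {u : ℝ} (h0 : 0 ≤ u) (h1 : u ≤ 1) :
    gaussianReal 0 1 {x | stdNormalCDF x ≤ u} = ENNReal.ofReal u := by
  rcases h0.eq_or_lt with rfl | h0
  · have : {x | stdNormalCDF x ≤ 0} = ∅ :=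
      Set.eq_empty_of_forall_notMem fun x hx => (stdNormalCDF_pos x).not_ge hx
    simp [this]
  rcases h1.eq_or_lt with rfl | h1
  · have : {x | stdNormalCDF x ≤ 1} = Set.univ :=
      Set.eq_univ_of_forall fun x => (stdNormalCDF_lt_one x).le
    simp [this]
  obtain ⟨x, hx⟩ : ∃ x, stdNormalCDF x = u :=
    mem_range_of_exists_le_of_exists_ge stdNormalCDF_continuous
      (((tendsto_cdf_atBot _).eventually (gt_mem_nhds h0)).exists.imp fun _ h => le_of_lt h)
      (((tendsto_cdf_atTop _).eventually (lt_mem_nhds h1)).exists.imp fun _ h => le_of_lt h)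
  have : {y | stdNormalCDF y ≤ u} = Set.Iic x := by
    ext y
    rw [Set.mem_ofPred_eq, ← hx, stdNormalCDF_strictMono.le_iff_le, Set.mem_Iic]
  rw [this, ← ofReal_cdf, ← hx, stdNormalCDF]

lemma map_normalQuantile (μ : Measure ℝ) [IsProbabilityMeasure μ] :
    (gaussianReal 0 1).map (quantile μ ∘ stdNormalCDF) = μ := by
  have hm := measurable_normalQuantile μ
  have := Measure.isProbabilityMeasure_map (μ := gaussianReal 0 1) hm.aemeasurable
  refine Measure.ext_of_Iic _ _ fun t => ?_
  rw [Measure.map_apply hm measurableSet_Iic, ← ofReal_cdf,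
    ← gaussian_setOf_stdNormalCDF_le (cdf_nonneg μ t) (cdf_le_one μ t)]
  congr 1
  ext x
  exact quantile_le_iff μ (stdNormalCDF_pos x) (stdNormalCDF_lt_one x) t

/-! ### Local Lipschitz constants and increments -/

lemma eventually_dist_le_of_localLip_lt {T : ℝ → ℝ} {x K : ℝ}
    (h : localLip T x < ENNReal.ofReal K) : ∀ᶠ z in 𝓝 x, dist (T z) (T x) ≤ K * dist z x := by
  simp only [localLip, iInf_lt_iff] at h
  obtain ⟨ε, hε, h⟩ := h
  have hK : 0 ≤ K := by
    by_contra hK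
    rw [ENNReal.ofReal_of_nonpos (by linarith)] at h
    exact not_lt_zero h
  filter_upwards [Metric.ball_mem_nhds x hε] with z hz
  have h1 : edist (T z) (T x) / edist z x ≤ ENNReal.ofReal K :=
    (le_iSup₂_of_le (f := fun u _ => ⨆ y ∈ Metric.ball x ε, edist (T u) (T y) / edist u y) z hz
      (le_iSup₂_of_le (f := fun y _ => edist (T z) (T y) / edist z y) x
        (Metric.mem_ball_self hε) le_rfl)).trans h.le
  rcases eq_or_ne z x with rfl | hzx
  · simp
  rw [ENNReal.div_le_iff (by simpa [edist_eq_zero] using hzx) (edist_ne_top _ _), edist_dist, edist_dist,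
    ← ENNReal.ofReal_mul hK, ENNReal.ofReal_le_ofReal_iff (by positivity)] at h1
  exact h1

/-- A mean value inequality without differentiability: the local constant bounds the right slopes at
every point, and it also forces continuity. -/
lemma sub_le_of_localLip_le {T : ℝ → ℝ} {a b K : ℝ} (hab : a ≤ b) (hK : 0 ≤ K)
    (h : ∀ x, x ∈ Set.Icc a b → localLip T x ≤ ENNReal.ofReal K) : T b - T a ≤ K * (b - a) := by
  have hev : ∀ x, x ∈ Set.Icc a b → ∀ r, K < r → ∀ᶠ z in 𝓝 x, dist (T z) (T x) ≤ r * dist z x :=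
    fun x hx r hr => eventually_dist_le_of_localLip_lt
      ((h x hx).trans_lt ((ENNReal.ofReal_lt_ofReal_iff (by linarith)).2 hr))
  have hc : ContinuousOn T (Set.Icc a b) := fun x hx => by
    refine ContinuousAt.continuousWithinAt ?_
    refine tendsto_iff_dist_tendsto_zero.2 (squeeze_zero' (Eventually.of_forall fun _ => dist_nonneg)
      (hev x hx (K + 1) (by linarith)) ?_)
    have : Tendsto (fun z => (K + 1) * dist z x) (𝓝 x) (𝓝 ((K + 1) * dist x x)) :=
      Continuous.tendsto (by fun_prop) x
    simpa using this
  have key := image_le_of_liminf_slope_right_le_deriv_boundary (f := T) (a := a) (b := b) hc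
    (B := fun x => T a + K * (x - a)) (B' := fun _ => K) (by simp) (by fun_prop)
    (fun x _ => by
      simpa using ((((hasDerivAt_id x).sub_const a).const_mul K).const_add (T a)).hasDerivWithinAt)
    (fun x hx r hr => by
      obtain ⟨r', hr1, hr2⟩ := exists_between hr
      refine Eventually.frequently ?_
      filter_upwards [(hev x ⟨hx.1, hx.2.le⟩ r' hr1).filter_mono nhdsWithin_le_nhds,
        self_mem_nhdsWithin] with z hz hzx
      rw [Set.mem_Ioi] at hzx
      rw [slope_def_field, div_lt_iff₀ (by linarith)]
      rw [Real.dist_eq, Real.dist_eq, abs_of_pos (by linarith : 0 < z - x)] at hz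
      nlinarith [le_abs_self (T z - T x)])
  have := key (Set.right_mem_Icc.2 hab)
  linarith

lemma abs_sub_le_of_localLip_le {T : ℝ → ℝ} {r : ℝ} (hr : 0 ≤ r) (hT : Monotone T)
    (h : ∀ x, localLip T x ≤ ENNReal.ofReal ((1 + |x|) ^ r)) {M : ℝ} {a b : ℝ} (ha : |a| ≤ M)
    (hb : |b| ≤ M) : |T b - T a| ≤ (1 + M) ^ r * |b - a| := by
  wlog hab : a ≤ b generalizing a b
  · rw [abs_sub_comm (T b), abs_sub_comm b]
    exact this hb ha (le_of_not_ge hab)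
  have hM : 0 ≤ M := (abs_nonneg a).trans ha
  rw [abs_of_nonneg (sub_nonneg.2 (hT hab)), abs_of_nonneg (sub_nonneg.2 hab)]
  refine sub_le_of_localLip_le hab (by positivity) fun x hx => (h x).trans ?_
  have : |x| ≤ M := abs_le.2 ⟨by linarith [(abs_le.1 ha).1, hx.1], by linarith [(abs_le.1 hb).2, hx.2]⟩
  gcongr

lemma abs_deriv_le_of_localLip_le {T : ℝ → ℝ} {x K : ℝ} (hK : 0 ≤ K)
    (h : localLip T x ≤ ENNReal.ofReal K) : |deriv T x| ≤ K := by
  refine le_of_forall_gt_imp_ge_of_dense fun r hr => ?_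
  refine norm_deriv_le_of_lip' (𝕜 := ℝ) (f := T) (hK.trans hr.le) ?_
  simpa only [dist_eq_norm] using eventually_dist_le_of_localLip_lt
      (h.trans_lt ((ENNReal.ofReal_lt_ofReal_iff (by linarith)).2 hr))

/-! ### Gaussian vectors: rotation invariance and moments -/

/-- The standard Gaussian measure on `Fin n → ℝ`. -/
noncomputable def stdGauss (n : ℕ) : Measure (Fin n → ℝ) :=
  Measure.pi fun _ => gaussianReal 0 1

instance isProbabilityMeasure_stdGauss (n : ℕ) : IsProbabilityMeasure (stdGauss n) := by
  unfold stdGauss; infer_instance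

lemma measurePreserving_eval_stdGauss (n : ℕ) (i : Fin n) :
    MeasurePreserving (fun x => x i) (stdGauss n) (gaussianReal 0 1) :=
  measurePreserving_eval (fun _ : Fin n => gaussianReal 0 1) i

lemma iIndepFun_eval_stdGauss (n : ℕ) : iIndepFun (fun i (x : Fin n → ℝ) => x i) (stdGauss n) :=
  iIndepFun_pi (X := fun _ => id) fun _ => aemeasurable_id

instance isGaussian_stdGauss (n : ℕ) : IsGaussian (stdGauss n) := by
  have h := (iIndepFun_eval_stdGauss n).hasGaussianLaw fun i => ⟨by
    rw [(measurePreserving_eval_stdGauss n i).map_eq]; infer_instance⟩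
  have h2 := h.isGaussian_map
  simpa using h2

lemma lintegral_prod_stdGauss {n : ℕ} (φ : Fin n → ℝ → ℝ≥0∞) (hφ : ∀ i, Measurable (φ i)) :
    ∫⁻ x, ∏ i, φ i (x i) ∂stdGauss n = ∏ i, ∫⁻ s, φ i s ∂gaussianReal 0 1 := by
  have h := lintegral_prod_eq_prod_lintegral_of_indepFun Finset.univ (fun i (x : Fin n → ℝ) => φ i (x i))
    ((iIndepFun_eval_stdGauss n).comp φ hφ) (fun i => (hφ i).comp (measurable_pi_apply i))
  rw [h]
  exact Finset.prod_congr rfl fun i _ => (measurePreserving_eval_stdGauss n i).lintegral_comp (hφ i)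

lemma integral_id_stdGauss (n : ℕ) : (stdGauss n)[id] = 0 := by
  ext i
  have hi : Integrable (id : (Fin n → ℝ) → Fin n → ℝ) (stdGauss n) :=
    memLp_one_iff_integrable.1 (IsGaussian.memLp_id _ 1 (by simp))
  have h1 := (ContinuousLinearMap.proj (R := ℝ) (φ := fun _ : Fin n => ℝ) i).integral_comp_comm hi
  have h2 : ∫ x, x i ∂stdGauss n = ∫ s, s ∂gaussianReal 0 1 := by
    rw [← (measurePreserving_eval_stdGauss n i).map_eq,
      integral_map (measurable_pi_apply i).aemeasurable (by fun_prop)]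
  rw [integral_id_gaussianReal] at h2
  simpa [h2] using h1.symm

lemma measurePreserving_rotation_stdGauss (n : ℕ) (θ : ℝ) :
    MeasurePreserving (ContinuousLinearMap.rotation (E := Fin n → ℝ) θ)
      ((stdGauss n).prod (stdGauss n)) ((stdGauss n).prod (stdGauss n)) :=
  ⟨by fun_prop, IsGaussian.map_rotation_eq_self (integral_id_stdGauss n) θ⟩

lemma lintegral_exp_mul_gaussianReal (t : ℝ) :
    ∫⁻ s, ENNReal.ofReal (Real.exp (t * s)) ∂gaussianReal 0 1
      = ENNReal.ofReal (Real.exp (t ^ 2 / 2)) := by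
  rw [← ofReal_integral_eq_lintegral_ofReal (integrable_exp_mul_gaussianReal t)
    (ae_of_all _ fun _ => (Real.exp_pos _).le)]
  have := congrFun (mgf_fun_id_gaussianReal (μ := 0) (v := 1)) t
  simp only [mgf] at this
  rw [this]; simp

lemma lintegral_exp_sum_stdGauss {n : ℕ} (c : Fin n → ℝ) :
    ∫⁻ y, ENNReal.ofReal (Real.exp (∑ i, c i * y i)) ∂stdGauss n
      = ENNReal.ofReal (Real.exp ((∑ i, c i ^ 2) / 2)) := by
  simp only [Real.exp_sum]
  simp_rw [ENNReal.ofReal_prod_of_nonneg fun _ _ => (Real.exp_pos _).le]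
  rw [lintegral_prod_stdGauss (fun i s => ENNReal.ofReal (Real.exp (c i * s))) (by fun_prop)]
  simp_rw [lintegral_exp_mul_gaussianReal]
  rw [← ENNReal.ofReal_prod_of_nonneg fun _ _ => (Real.exp_pos _).le, ← Real.exp_sum,
    Finset.sum_div]

lemma pow_le_factorial_mul_exp_add_exp (u : ℝ) (k : ℕ) :
    u ^ (2 * k) ≤ (2 * k).factorial * (Real.exp u + Real.exp (-u)) := by
  have h1 : |u| ^ (2 * k) / (2 * k).factorial ≤ Real.exp |u| :=
    Real.pow_div_factorial_le_exp _ (abs_nonneg u) _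
  have h2 : Real.exp |u| ≤ Real.exp u + Real.exp (-u) := by
    rcases abs_cases u with h | h <;> rw [h.1] <;> linarith [Real.exp_pos u, Real.exp_pos (-u)]
  rw [div_le_iff₀ (by positivity), pow_mul, sq_abs, ← pow_mul] at h1
  nlinarith [(by positivity : (0:ℝ) < (2 * k).factorial)]

/-- Moments of a Gaussian linear form. -/
lemma lintegral_sum_pow_stdGauss_le {n : ℕ} (c : Fin n → ℝ) {k : ℕ} (hk : 1 ≤ k) :
    ∫⁻ y, ENNReal.ofReal ((∑ i, c i * y i) ^ (2 * k)) ∂stdGauss n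
      ≤ ENNReal.ofReal ((24 * k * ∑ i, c i ^ 2) ^ k) := by
  set V := ∑ i, c i ^ 2 with hV
  rcases (Finset.sum_nonneg fun i _ => sq_nonneg (c i) : 0 ≤ V).eq_or_lt with h0 | (h0 : 0 < V)
  · have hc : ∀ i, c i = 0 := fun i => by
      have := (Finset.sum_eq_zero_iff_of_nonneg fun i _ => sq_nonneg (c i)).1 h0.symm i
        (Finset.mem_univ i)
      simpa using this
    simp [hc, show k ≠ 0 by omega]
  have hk0 : (0:ℝ) < k := by exact_mod_cast hk
  -- Chosen so that the exponential moment of τ times the linear form is exactly e^k.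
  set τ := Real.sqrt (2 * k / V) with hτ
  have hτ2 : τ ^ 2 = 2 * k / V := Real.sq_sqrt (by positivity)
  have hτ0 : 0 < τ := Real.sqrt_pos.2 (by positivity)
  set B : ℝ := (2 * k).factorial / τ ^ (2 * k) with hB
  have hB0 : 0 ≤ B := by positivity
  have hpt : ∀ y : Fin n → ℝ, ENNReal.ofReal ((∑ i, c i * y i) ^ (2 * k))
      ≤ ENNReal.ofReal B * (ENNReal.ofReal (Real.exp (∑ i, (τ * c i) * y i))
        + ENNReal.ofReal (Real.exp (∑ i, (-τ * c i) * y i))) := by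
    intro y
    rw [← ENNReal.ofReal_add (by positivity) (by positivity), ← ENNReal.ofReal_mul hB0]
    refine ENNReal.ofReal_le_ofReal ?_
    have h := pow_le_factorial_mul_exp_add_exp (τ * ∑ i, c i * y i) k
    have e1 : ∑ i, (τ * c i) * y i = τ * ∑ i, c i * y i := by
      rw [Finset.mul_sum]; exact Finset.sum_congr rfl fun i _ => by ring
    have e2 : ∑ i, (-τ * c i) * y i = -(τ * ∑ i, c i * y i) := by
      rw [Finset.mul_sum, ← Finset.sum_neg_distrib]; exact Finset.sum_congr rfl fun i _ => by ring
    rw [e1, e2, hB, div_mul_eq_mul_div, le_div_iff₀ (by positivity), mul_comm, ← mul_pow]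
    exact h
  refine (lintegral_mono hpt).trans ?_
  rw [lintegral_const_mul _ (by fun_prop), lintegral_add_left (by fun_prop),
    lintegral_exp_sum_stdGauss, lintegral_exp_sum_stdGauss]
  have e : ∀ σ : ℝ, σ ^ 2 = τ ^ 2 → (∑ i, (σ * c i) ^ 2) / 2 = k := by
    intro σ hσ
    simp_rw [mul_pow, hσ, ← Finset.mul_sum, ← hV, hτ2]
    field_simp
  rw [e τ rfl, e (-τ) (by ring), ← ENNReal.ofReal_add (by positivity) (by positivity),
    ← ENNReal.ofReal_mul hB0]
  refine ENNReal.ofReal_le_ofReal ?_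
  have hfac : ((2 * k).factorial : ℝ) ≤ (2 * k : ℝ) ^ (2 * k) := by
    exact_mod_cast Nat.factorial_le_pow (2 * k)
  have hexp : Real.exp k ≤ 3 ^ k := by
    rw [← Real.exp_one_pow]
    exact pow_le_pow_left₀ (Real.exp_pos 1).le (by linarith [Real.exp_one_lt_d9]) k
  have h2 : (2:ℝ) ≤ 2 ^ k := by
    calc (2:ℝ) = 2 ^ 1 := by norm_num
      _ ≤ 2 ^ k := pow_le_pow_right₀ (by norm_num) hk
  calc B * (Real.exp k + Real.exp k) ≤ (2 * k : ℝ) ^ (2 * k) / τ ^ (2 * k) * (2 ^ k * 3 ^ k) := by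
        rw [← two_mul, hB]
        gcongr
    _ = (12 * k * V) ^ k := by
        rw [pow_mul, pow_mul τ, hτ2, ← div_pow, ← mul_pow, ← mul_pow]
        congr 1
        field_simp
        ring
    _ ≤ _ := by gcongr; norm_num

lemma lintegral_norm_pow_stdGauss_lt_top (n m : ℕ) :
    ∫⁻ x, ENNReal.ofReal ((1 + ‖x‖) ^ m) ∂stdGauss n < ∞ := by
  rcases Nat.eq_zero_or_pos m with rfl | hm
  · simp
  have h0 : MemLp (fun x : Fin n → ℝ => ‖x‖) (m : ℝ≥0∞) (stdGauss n) :=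
    (IsGaussian.memLp_id (stdGauss n) (m : ℝ≥0∞) (ENNReal.natCast_ne_top m)).norm
  have h1 : MemLp (fun x : Fin n → ℝ => 1 + ‖x‖) (m : ℝ≥0∞) (stdGauss n) :=
    (memLp_const (1 : ℝ)).add h0
  have h2 := h1.integrable_norm_pow (by omega)
  refine lt_of_le_of_lt (lintegral_mono fun x => ?_) h2.hasFiniteIntegral
  rw [← ofReal_norm, norm_pow, norm_norm, Real.norm_of_nonneg (by positivity)]

lemma lintegral_norm_pow_prod_stdGauss_lt_top (n m : ℕ) :
    ∫⁻ p, ENNReal.ofReal ((1 + ‖p.1‖ + ‖p.2‖) ^ m) ∂(stdGauss n).prod (stdGauss n) < ∞ := by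
  have h : ∀ p : (Fin n → ℝ) × (Fin n → ℝ), ENNReal.ofReal ((1 + ‖p.1‖ + ‖p.2‖) ^ m)
      ≤ ENNReal.ofReal ((1 + ‖p.1‖) ^ m) * ENNReal.ofReal ((1 + ‖p.2‖) ^ m) := fun p => by
    rw [← ENNReal.ofReal_mul (by positivity), ← mul_pow]
    refine ENNReal.ofReal_le_ofReal (pow_le_pow_left₀ (by positivity) ?_ m)
    nlinarith [mul_nonneg (norm_nonneg p.1) (norm_nonneg p.2)]
  refine (lintegral_mono h).trans_lt ?_
  rw [lintegral_prod_mul (f := fun x : Fin n → ℝ => ENNReal.ofReal ((1 + ‖x‖) ^ m))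
    (g := fun x : Fin n → ℝ => ENNReal.ofReal ((1 + ‖x‖) ^ m)) (by fun_prop) (by fun_prop)]
  exact ENNReal.mul_lt_top (lintegral_norm_pow_stdGauss_lt_top n m)
    (lintegral_norm_pow_stdGauss_lt_top n m)

/-! ### Maurey-Pisier inequality by rotation -/

/-- The increment over a rotation by the angle `π / (2 N)` controls the increment over a
quarter turn. -/
lemma lintegral_sub_pow_le_of_rotation {n : ℕ} {g : (Fin n → ℝ) → ℝ} (hg : Measurable g) (k : ℕ)
    {N : ℕ} (hN : 1 ≤ N) {δ : ℝ} (hδ : N * δ = Real.pi / 2) :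
    ∫⁻ p, ENNReal.ofReal ((g p.1 - g p.2) ^ (2 * k)) ∂(stdGauss n).prod (stdGauss n)
      ≤ ∫⁻ p, ENNReal.ofReal
          ((N * (g (Real.cos δ • p.1 + Real.sin δ • p.2) - g p.1)) ^ (2 * k))
          ∂(stdGauss n).prod (stdGauss n) := by
  have hN0 : (0:ℝ) < N := by exact_mod_cast hN
  set R := fun θ : ℝ => ContinuousLinearMap.rotation (E := Fin n → ℝ) θ with hR
  set D : (Fin n → ℝ) × (Fin n → ℝ) → ℝ := fun p =>
    g (Real.cos δ • p.1 + Real.sin δ • p.2) - g p.1 with hD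
  set H : (Fin n → ℝ) × (Fin n → ℝ) → ℝ≥0∞ := fun p => ENNReal.ofReal ((N * D p) ^ (2 * k)) with hH
  have hDm : Measurable D := by fun_prop
  have hHm : Measurable H := by fun_prop
  have hpt : ∀ p, ENNReal.ofReal ((g p.1 - g p.2) ^ (2 * k))
      ≤ ∑ j ∈ Finset.range N, ENNReal.ofReal (1 / N) * H (R (j * δ) p) := by
    intro p
    -- Telescoping along the quarter circle from `p.1` to `p.2`: each increment is the first one
    -- evaluated at a rotated pair. Convexity of the even power then averages the terms, which all
    -- have the same law.
    have htel : g p.2 - g p.1 = ∑ j ∈ Finset.range N, D (R (j * δ) p) := by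
      have h := Finset.sum_range_sub (fun j : ℕ => g (R (j * δ) p).1) N
      have h0 : (R (((0:ℕ):ℝ) * δ) p).1 = p.1 := by simp [hR, ContinuousLinearMap.rotation_apply]
      have h1 : (R ((N:ℝ) * δ) p).1 = p.2 := by
        rw [hδ]; simp [hR, ContinuousLinearMap.rotation_apply]
      simp only [h0, h1] at h
      rw [← h]
      refine Finset.sum_congr rfl fun j _ => ?_
      simp only [hD]
      congr 2
      ext i
      simp only [hR, ContinuousLinearMap.rotation_apply, Pi.add_apply, Pi.smul_apply, smul_eq_mul]
      push_cast
      rw [add_mul, one_mul, Real.cos_add, Real.sin_add]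
      ring
    have hJ := Real.pow_arith_mean_le_arith_mean_pow_of_even (Finset.range N)
      (fun _ => 1 / (N:ℝ)) (fun j => N * D (R (j * δ) p)) (fun _ _ => by positivity)
      (by simp [hN0.ne']) (n := 2 * k) (even_two_mul k)
    have hs : ∑ j ∈ Finset.range N, 1 / (N:ℝ) * (N * D (R (j * δ) p)) = g p.2 - g p.1 := by
      rw [htel]
      refine Finset.sum_congr rfl fun j _ => ?_
      field_simp
    rw [hs] at hJ
    have he : (g p.1 - g p.2) ^ (2 * k) = (g p.2 - g p.1) ^ (2 * k) := by
      rw [← neg_sub, (even_two_mul k).neg_pow]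
    rw [he]
    refine (ENNReal.ofReal_le_ofReal hJ).trans ?_
    rw [ENNReal.ofReal_sum_of_nonneg fun j _ =>
      mul_nonneg (by positivity) ((even_two_mul k).pow_nonneg _)]
    refine Finset.sum_le_sum fun j _ => ?_
    rw [ENNReal.ofReal_mul (by positivity)]
  refine (lintegral_mono hpt).trans ?_
  rw [lintegral_finsetSum _ fun j _ => by fun_prop]
  have hj : ∀ j : ℕ, ∫⁻ p, ENNReal.ofReal (1 / N) * H (R (j * δ) p)
      ∂(stdGauss n).prod (stdGauss n)
      = ENNReal.ofReal (1 / N) * ∫⁻ p, H p ∂(stdGauss n).prod (stdGauss n) := fun j => by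
    rw [lintegral_const_mul _ (by fun_prop),
      (measurePreserving_rotation_stdGauss n (j * δ)).lintegral_comp hHm]
  simp_rw [hj]
  rw [Finset.sum_const, Finset.card_range, nsmul_eq_mul, ← mul_assoc, ← ENNReal.ofReal_natCast,
    ← ENNReal.ofReal_mul hN0.le, mul_one_div_cancel hN0.ne', ENNReal.ofReal_one, one_mul]

lemma norm_rotation_sub_le {n : ℕ} (x y : Fin n → ℝ) (δ : ℝ) :
    ‖Real.cos δ • x + Real.sin δ • y - x‖ ≤ |δ| * (‖x‖ + ‖y‖) := by
  have hc : |Real.cos δ - 1| ≤ |δ| := by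
    have := Real.lipschitzWith_cos.dist_le_mul δ 0
    simpa [Real.dist_eq] using this
  have hs : |Real.sin δ| ≤ |δ| := Real.abs_sin_le_abs
  have : Real.cos δ • x + Real.sin δ • y - x = (Real.cos δ - 1) • x + Real.sin δ • y := by
    rw [sub_smul, one_smul]; abel
  rw [this, mul_add]
  refine (norm_add_le _ _).trans ?_
  rw [norm_smul, norm_smul, Real.norm_eq_abs, Real.norm_eq_abs]
  gcongr

lemma fderiv_apply_eq_sum_partialDeriv {n : ℕ} (f : (Fin n → ℝ) → ℝ) (x v : Fin n → ℝ) :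
    fderiv ℝ f x v = ∑ i, partialDeriv f i x * v i := by
  conv_lhs => rw [← Finset.univ_sum_single v]
  rw [map_sum]
  refine Finset.sum_congr rfl fun i _ => ?_
  have : (Pi.single i (v i) : Fin n → ℝ) = v i • Pi.single i (1:ℝ) := by
    rw [← Pi.single_smul, smul_eq_mul, mul_one]
  rw [this, map_smul, smul_eq_mul, mul_comm, partialDeriv]

set_option maxHeartbeats 1000000 in
/-- A Maurey-Pisier type inequality for a Lipschitz function of coordinatewise transported
Gaussian vectors. -/
lemma lintegral_sub_pow_comp_le {n : ℕ} {T : Fin n → ℝ → ℝ} {f : (Fin n → ℝ) → ℝ}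
    (hf : Differentiable ℝ f) (hTm : ∀ i, Monotone (T i)) {r : ℝ} (hr : 0 ≤ r)
    (hT : ∀ i x, localLip (T i) x ≤ ENNReal.ofReal ((1 + |x|) ^ r)) {M : ℝ}
    (hM : ∀ x, ‖fderiv ℝ f x‖ ≤ M) {k : ℕ} (hk : 1 ≤ k) :
    ∫⁻ p, ENNReal.ofReal ((f (fun i => T i (p.1 i)) - f (fun i => T i (p.2 i))) ^ (2 * k))
        ∂(stdGauss n).prod (stdGauss n)
      ≤ ∫⁻ x, ENNReal.ofReal ((96 * k *
          ∑ i, (partialDeriv f i (fun j => T j (x j)) * deriv (T i) (x i)) ^ 2) ^ k)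
          ∂stdGauss n := by
  have hM0 : 0 ≤ M := (norm_nonneg _).trans (hM 0)
  set S : (Fin n → ℝ) → (Fin n → ℝ) := fun x i => T i (x i) with hS
  have hSm : Measurable S := measurable_pi_lambda _ fun i =>
    (hTm i).measurable.comp (measurable_pi_apply i)
  have hfm : Measurable f := hf.continuous.measurable
  set g : (Fin n → ℝ) → ℝ := fun x => f (S x) with hg
  have hgm : Measurable g := hfm.comp hSm
  set c : Fin n → (Fin n → ℝ) → ℝ := fun i x => partialDeriv f i (S x) * deriv (T i) (x i) with hc
  have hcm : ∀ i, Measurable (c i) := fun i =>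
    ((measurable_fderiv_apply_const ℝ f (Pi.single i 1)).comp hSm).mul
      ((measurable_deriv (T i)).comp (measurable_pi_apply i))
  set δ : ℕ → ℝ := fun N => Real.pi / 2 / (N + 1 : ℕ) with hδ
  have hδ1 : ∀ N : ℕ, ((N + 1 : ℕ) : ℝ) * δ N = Real.pi / 2 := fun N => by
    simp only [hδ]; field_simp
  have hδ0 : ∀ N, 0 < δ N := fun N => by simp only [hδ]; positivity
  have hδt : Tendsto δ atTop (𝓝[≠] 0) := by
    refine tendsto_nhdsWithin_iff.2 ⟨?_, Eventually.of_forall fun N => (hδ0 N).ne'⟩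
    exact (tendsto_const_div_atTop_nhds_zero_nat (Real.pi / 2)).comp (tendsto_add_atTop_nat 1)
  set F : ℕ → (Fin n → ℝ) × (Fin n → ℝ) → ℝ := fun N p =>
    ((N + 1 : ℕ) : ℝ) * (g (Real.cos (δ N) • p.1 + Real.sin (δ N) • p.2) - g p.1) with hF
  have hFm : ∀ N, Measurable (F N) := fun N => by fun_prop
  -- The transported map has local Lipschitz constant of growth r and the rotation displaces by at
  -- most δ times the norms; together, polynomial growth of degree at most m dominates all rescaled
  -- increments uniformly in `N`.
  set m : ℕ := ⌈r⌉₊ + 1 with hm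
  have hbound : ∀ N p, ENNReal.ofReal (F N p ^ (2 * k)) ≤
      ENNReal.ofReal ((2 * M) ^ (2 * k)) *
        ENNReal.ofReal ((1 + ‖p.1‖ + ‖p.2‖) ^ (m * (2 * k))) := by
    intro N p
    rw [← ENNReal.ofReal_mul (by positivity), pow_mul _ m, ← mul_pow]
    refine ENNReal.ofReal_le_ofReal ?_
    rw [← (even_two_mul k).pow_abs]
    refine pow_le_pow_left₀ (abs_nonneg _) ?_ _
    set z := Real.cos (δ N) • p.1 + Real.sin (δ N) • p.2 with hz
    set Q := 1 + ‖p.1‖ + ‖p.2‖ with hQ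
    have hQ1 : 1 ≤ Q := by simp only [hQ]; linarith [norm_nonneg p.1, norm_nonneg p.2]
    have hzn : ‖z‖ ≤ ‖p.1‖ + ‖p.2‖ := by
      refine (norm_add_le _ _).trans (add_le_add ?_ ?_)
      · rw [norm_smul]
        exact mul_le_of_le_one_left (norm_nonneg _) (Real.abs_cos_le_one _)
      · rw [norm_smul]
        exact mul_le_of_le_one_left (norm_nonneg _) (Real.abs_sin_le_one _)
    have h1 : |g z - g p.1| ≤ M * ‖S z - S p.1‖ :=
      Convex.norm_image_sub_le_of_norm_fderiv_le (fun x _ => hf x) (fun x _ => hM x) convex_univ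
        (Set.mem_univ _) (Set.mem_univ _)
    have h2 : ‖S z - S p.1‖ ≤ Q ^ r * (δ N * Q) := by
      refine (pi_norm_le_iff_of_nonneg (by have := hδ0 N; positivity)).2 fun i => ?_
      have h3 := abs_sub_le_of_localLip_le hr (hTm i) (hT i) (M := ‖p.1‖ + ‖p.2‖) (a := p.1 i)
        (b := z i) ((norm_le_pi_norm p.1 i).trans (by linarith [norm_nonneg p.2]))
        ((norm_le_pi_norm z i).trans hzn)
      have h4 : |z i - p.1 i| ≤ δ N * Q := by
        refine (norm_le_pi_norm (z - p.1) i).trans ((norm_rotation_sub_le p.1 p.2 (δ N)).trans ?_)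
        rw [abs_of_pos (hδ0 N)]
        have := hδ0 N
        gcongr
        simp only [hQ]; linarith
      rw [← add_assoc] at h3
      refine h3.trans ?_
      gcongr
    have h5 : |F N p| ≤ Real.pi / 2 * (M * (Q ^ r * Q)) := by
      rw [← hδ1 N, hF]
      simp only
      rw [abs_mul, abs_of_nonneg (by positivity : (0:ℝ) ≤ ((N + 1 : ℕ) : ℝ)), mul_assoc]
      refine mul_le_mul_of_nonneg_left (h1.trans ?_) (by positivity)
      calc M * ‖S z - S p.1‖ ≤ M * (Q ^ r * (δ N * Q)) := by gcongr
        _ = δ N * (M * (Q ^ r * Q)) := by ring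
    have h6 : Q ^ r * Q ≤ Q ^ m := by
      rw [hm, pow_succ]
      gcongr
      rw [← Real.rpow_natCast]
      exact Real.rpow_le_rpow_of_exponent_le hQ1 (Nat.le_ceil r)
    calc |F N p| ≤ Real.pi / 2 * (M * (Q ^ r * Q)) := h5
      _ ≤ 2 * (M * Q ^ m) := by
        gcongr
        linarith [Real.pi_le_four]
      _ = 2 * M * Q ^ m := by ring
  have hfin : ∫⁻ p, ENNReal.ofReal ((2 * M) ^ (2 * k)) *
      ENNReal.ofReal ((1 + ‖p.1‖ + ‖p.2‖) ^ (m * (2 * k)))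
      ∂(stdGauss n).prod (stdGauss n) ≠ ∞ := by
    rw [lintegral_const_mul _ (by fun_prop)]
    exact (ENNReal.mul_lt_top ENNReal.ofReal_lt_top
      (lintegral_norm_pow_prod_stdGauss_lt_top n _)).ne
  -- Monotone functions are differentiable Lebesgue-almost everywhere. This suffices because the
  -- small-angle limit is needed only almost everywhere.
  have hdiff : ∀ᵐ x ∂stdGauss n, ∀ i, DifferentiableAt ℝ (T i) (x i) := by
    rw [ae_all_iff]
    intro i
    exact (measurePreserving_eval_stdGauss n i).quasiMeasurePreserving.ae
      ((gaussianReal_absolutelyContinuous 0 one_ne_zero).ae_le (hTm i).ae_differentiableAt)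
  have hdiff' : ∀ᵐ p ∂(stdGauss n).prod (stdGauss n), ∀ i, DifferentiableAt ℝ (T i) (p.1 i) :=
    Measure.quasiMeasurePreserving_fst.ae hdiff
  have hlim : ∀ᵐ p ∂(stdGauss n).prod (stdGauss n), Tendsto
      (fun N => ENNReal.ofReal (F N p ^ (2 * k))) atTop
      (𝓝 (ENNReal.ofReal ((∑ i, Real.pi / 2 * c i p.1 * p.2 i) ^ (2 * k)))) := by
    filter_upwards [hdiff'] with p hp
    refine (ENNReal.continuous_ofReal.tendsto _).comp (Tendsto.pow ?_ _)
    -- At angle 0 the point on the circle is `p.1` and its velocity is `p.2`, so the limit is a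
    -- linear form in `p.2` with coefficients depending on `p.1` only.
    have hz : HasDerivAt (fun θ : ℝ => S (Real.cos θ • p.1 + Real.sin θ • p.2))
        (fun i => deriv (T i) (p.1 i) * p.2 i) 0 := by
      refine hasDerivAt_pi.2 fun i => ?_
      have h1 : HasDerivAt (fun θ : ℝ => Real.cos θ * p.1 i + Real.sin θ * p.2 i) (p.2 i) 0 := by
        simpa using ((Real.hasDerivAt_cos 0).mul_const (p.1 i)).fun_add
          ((Real.hasDerivAt_sin 0).mul_const (p.2 i))
      have h2 : HasDerivAt (T i) (deriv (T i) (p.1 i))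
          (Real.cos 0 * p.1 i + Real.sin 0 * p.2 i) := by
        simpa using (hp i).hasDerivAt
      exact HasDerivAt.comp 0 h2 h1
    have hgd : HasDerivAt (fun θ : ℝ => g (Real.cos θ • p.1 + Real.sin θ • p.2))
        (fderiv ℝ f (S p.1) (fun i => deriv (T i) (p.1 i) * p.2 i)) 0 := by
      have h2 : HasFDerivAt f (fderiv ℝ f (S p.1))
          (S (Real.cos 0 • p.1 + Real.sin 0 • p.2)) := by
        simpa using (hf (S p.1)).hasFDerivAt
      exact h2.comp_hasDerivAt 0 hz
    have ht := (hgd.tendsto_slope_zero.comp hδt).const_mul (Real.pi / 2)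
    have he : Real.pi / 2 * fderiv ℝ f (S p.1) (fun i => deriv (T i) (p.1 i) * p.2 i)
        = ∑ i, Real.pi / 2 * c i p.1 * p.2 i := by
      rw [fderiv_apply_eq_sum_partialDeriv, Finset.mul_sum]
      exact Finset.sum_congr rfl fun i _ => by simp only [hc]; ring
    rw [he] at ht
    refine ht.congr fun N => ?_
    have := (hδ0 N).ne'
    simp only [Function.comp, zero_add, Real.cos_zero, Real.sin_zero, one_smul, zero_smul,
      add_zero, smul_eq_mul, hF]
    rw [← hδ1 N]
    field_simp
  have hdct := tendsto_lintegral_of_dominated_convergence _ (fun N => by fun_prop)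
    (fun N => ae_of_all _ (hbound N)) hfin hlim
  refine (ge_of_tendsto' hdct fun N =>
    lintegral_sub_pow_le_of_rotation hgm k (Nat.le_add_left 1 N) (hδ1 N)).trans ?_
  -- With the first vector frozen, the inner integral is a moment of a Gaussian linear form; the
  -- constant is 24 (π/2)² ≤ 96.
  rw [lintegral_prod _ (by fun_prop)]
  refine lintegral_mono fun x => 
    (lintegral_sum_pow_stdGauss_le (fun i => Real.pi / 2 * c i x) hk).trans ?_
  refine ENNReal.ofReal_le_ofReal ?_
  have hpi : (Real.pi / 2) ^ 2 ≤ 4 := by nlinarith [Real.pi_le_four, Real.pi_pos]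
  simp_rw [mul_pow (Real.pi / 2), ← Finset.mul_sum]
  have h0 : 0 ≤ ∑ i, c i x ^ 2 := Finset.sum_nonneg fun i _ => sq_nonneg _
  refine pow_le_pow_left₀ (by positivity) ?_ k
  calc 24 * k * ((Real.pi / 2) ^ 2 * ∑ i, c i x ^ 2) ≤ 24 * k * (4 * ∑ i, c i x ^ 2) := by gcongr
    _ = 96 * k * ∑ i, c i x ^ 2 := by ring

/-! ### Moments of sums with Weibull tails -/

lemma le_mul_exp_div {x r c : ℝ} (hr : 0 < r) (hc : 0 < c) :
    x ≤ r / c * Real.exp (c / r * x) := by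
  have h := Real.add_one_le_exp (c / r * x)
  have h2 : x = r / c * (c / r * x) := by field_simp
  calc x = r / c * (c / r * x) := h2
    _ ≤ r / c * Real.exp (c / r * x) := by gcongr; linarith

lemma rpow_le_mul_exp {x r c : ℝ} (hx : 0 ≤ x) (hr : 0 < r) (hc : 0 < c) :
    x ^ r ≤ (r / c) ^ r * Real.exp (c * x) := by
  calc x ^ r ≤ (r / c * Real.exp (c / r * x)) ^ r :=
        Real.rpow_le_rpow hx (le_mul_exp_div hr hc) hr.le
    _ = (r / c) ^ r * Real.exp (c * x) := by
        rw [Real.mul_rpow (by positivity) (by positivity), ← Real.exp_mul]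
        congr 2
        field_simp

/-- A concave function that is linear near the origin and behaves like `y ^ (1 / r)` at
infinity. -/
noncomputable def truncRoot (r κ y : ℝ) : ℝ := y * (κ ^ r + y) ^ (1 / r - 1)

lemma truncRoot_nonneg {r κ y : ℝ} (hκ : 0 < κ) (hy : 0 ≤ y) : 0 ≤ truncRoot r κ y := by
  unfold truncRoot; positivity

lemma truncRoot_le_mul {r κ y : ℝ} (hr : 1 ≤ r) (hκ : 0 < κ) (hy : 0 ≤ y) :
    truncRoot r κ y ≤ κ ^ (1 - r) * y := by
  have hr0 : 0 < r := by linarith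
  have h1 : (κ ^ r + y) ^ (1 / r - 1) ≤ (κ ^ r) ^ (1 / r - 1) :=
    Real.rpow_le_rpow_of_nonpos (by positivity) (by linarith)
      (by rw [sub_nonpos, div_le_one hr0]; exact hr)
  rw [← Real.rpow_mul hκ.le, mul_sub, mul_one_div_cancel hr0.ne', mul_one] at h1
  rw [truncRoot, mul_comm]
  gcongr

lemma truncRoot_le_of_le_rpow {r κ y v : ℝ} (hr : 1 ≤ r) (hκ : 0 < κ) (hy : 0 ≤ y) (hv : 0 ≤ v)
    (h : y ≤ v ^ r) : truncRoot r κ y ≤ v := by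
  have hr0 : 0 < r := by linarith
  rcases hy.eq_or_lt with rfl | hy
  · simpa [truncRoot] using hv
  have h1 : (κ ^ r + y) ^ (1 / r - 1) ≤ y ^ (1 / r - 1) :=
    Real.rpow_le_rpow_of_nonpos hy (by linarith [Real.rpow_pos_of_pos hκ r])
      (by rw [sub_nonpos, div_le_one hr0]; exact hr)
  calc truncRoot r κ y ≤ y * y ^ (1 / r - 1) := by unfold truncRoot; gcongr
    _ = y ^ (1 / r) := by rw [Real.rpow_sub_one hy.ne']; field_simp
    _ ≤ (v ^ r) ^ (1 / r) := by gcongr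
    _ = v := by rw [← Real.rpow_mul hv, mul_one_div_cancel hr0.ne', Real.rpow_one]

/-- The factor (κ^r + y)^(1/r - 1) is nonincreasing in y, so it only grows when the whole sum is
replaced by one summand. Subadditivity is what lets the exponential factorize. -/
lemma truncRoot_sum_le {ι : Type*} (s : Finset ι) {r κ : ℝ} {y : ι → ℝ} (hr : 1 ≤ r) (hκ : 0 < κ)
    (hy : ∀ i ∈ s, 0 ≤ y i) : truncRoot r κ (∑ i ∈ s, y i) ≤ ∑ i ∈ s, truncRoot r κ (y i) := by
  unfold truncRoot
  rw [Finset.sum_mul]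
  refine Finset.sum_le_sum fun i hi => mul_le_mul_of_nonneg_left ?_ (hy i hi)
  exact Real.rpow_le_rpow_of_nonpos (by have := hy i hi; positivity)
    (by linarith [Finset.single_le_sum hy hi])
    (by rw [sub_nonpos, div_le_one (by linarith)]; exact hr)

/-- With h = `truncRoot r k y`, one has (k^r + y)^(1/r) ≤ k + h, hence y ≤ k^r (1 + h/k)^r. The last
power is absorbed by an exponential of c h/k, and the k-th power removes the division by k. -/
lemma pow_le_mul_exp_truncRoot {r c y : ℝ} {k : ℕ} (hr : 1 ≤ r) (hc : 0 < c) (hk : 1 ≤ k)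
    (hy : 0 ≤ y) :
    y ^ k ≤ ((r / c) ^ r * Real.exp c * (k : ℝ) ^ r) ^ k * Real.exp (c * truncRoot r k y) := by
  have hr0 : 0 < r := by linarith
  have hk0 : (0:ℝ) < k := by exact_mod_cast hk
  set h := truncRoot r k y with hh
  have hh0 : 0 ≤ h := truncRoot_nonneg hk0 hy
  have h1 : ((k:ℝ) ^ r + y) ^ (1 / r) ≤ k + h := by
    have e : ((k:ℝ) ^ r + y) ^ (1 / r)
        = (k:ℝ) ^ r * ((k:ℝ) ^ r + y) ^ (1 / r - 1) + h := by
      rw [hh, truncRoot, ← add_mul, Real.rpow_sub_one (by positivity)]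
      field_simp
    have h2 : (k:ℝ) ^ r * ((k:ℝ) ^ r + y) ^ (1 / r - 1)
        ≤ (k:ℝ) ^ r * ((k:ℝ) ^ r) ^ (1 / r - 1) :=
      mul_le_mul_of_nonneg_left (Real.rpow_le_rpow_of_nonpos (by positivity) (by linarith)
        (by rw [sub_nonpos, div_le_one hr0]; exact hr)) (by positivity)
    have h3 : (k:ℝ) ^ r * ((k:ℝ) ^ r) ^ (1 / r - 1) = k := by
      rw [← Real.rpow_mul hk0.le, ← Real.rpow_add hk0]
      have : r + r * (1 / r - 1) = 1 := by field_simp; ring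
      rw [this, Real.rpow_one]
    linarith
  have h4 : y ≤ (k + h) ^ r := by
    calc y ≤ (k:ℝ) ^ r + y := by linarith [Real.rpow_pos_of_pos hk0 r]
      _ = (((k:ℝ) ^ r + y) ^ (1 / r)) ^ r := by
        rw [← Real.rpow_mul (by positivity), one_div_mul_cancel hr0.ne', Real.rpow_one]
      _ ≤ (k + h) ^ r := Real.rpow_le_rpow (by positivity) h1 hr0.le
  have h5 : y ≤ (r / c) ^ r * Real.exp c * (k:ℝ) ^ r * Real.exp (c * h / k) := by
    have e : (k + h) ^ r = (k:ℝ) ^ r * (1 + h / k) ^ r := by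
      rw [← Real.mul_rpow hk0.le (by positivity)]
      congr 1
      field_simp
    have h6 := rpow_le_mul_exp (x := 1 + h / k) (by positivity) hr0 hc
    rw [mul_add, mul_one, Real.exp_add] at h6
    calc y ≤ (k:ℝ) ^ r * (1 + h / k) ^ r := e ▸ h4
      _ ≤ (k:ℝ) ^ r * ((r / c) ^ r * (Real.exp c * Real.exp (c * (h / k)))) := by gcongr
      _ = _ := by rw [mul_div_assoc]; ring
  calc y ^ k ≤ ((r / c) ^ r * Real.exp c * (k:ℝ) ^ r * Real.exp (c * h / k)) ^ k :=
        pow_le_pow_left₀ hy h5 k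
    _ = _ := by
        rw [mul_pow, ← Real.exp_nat_mul]
        congr 2
        field_simp

/-- In e^u ≤ 1 + u e^u, the factor u is bounded linearly in y and the exponent by the root bound.
The excess over 1 is thus linear in y, which makes a product of many expectations summable in the
exponent. -/
lemma exp_mul_truncRoot_le {r κ y v c : ℝ} (hr : 1 ≤ r) (hκ : 0 < κ) (hc : 0 ≤ c) (hy : 0 ≤ y)
    (hv : 0 ≤ v) (h : y ≤ v ^ r) :
    Real.exp (c * truncRoot r κ y) ≤ 1 + c * κ ^ (1 - r) * (y * Real.exp (c * v)) := by
  set u := c * truncRoot r κ y with hu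
  have hu0 : 0 ≤ u := mul_nonneg hc (truncRoot_nonneg hκ hy)
  have h1 : Real.exp u ≤ 1 + u * Real.exp u := by
    have h2 := Real.add_one_le_exp (-u)
    rw [Real.exp_neg] at h2
    have h3 := mul_le_mul_of_nonneg_right h2 (Real.exp_pos u).le
    rw [inv_mul_cancel₀ (Real.exp_pos u).ne'] at h3
    linarith
  have h2 : u ≤ c * (κ ^ (1 - r) * y) := by
    rw [hu]; gcongr; exact truncRoot_le_mul hr hκ hy
  have h3 : u ≤ c * v := by
    rw [hu]; gcongr; exact truncRoot_le_of_le_rpow hr hκ hy hv h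
  calc Real.exp u ≤ 1 + u * Real.exp u := h1
    _ ≤ 1 + c * (κ ^ (1 - r) * y) * Real.exp (c * v) := by gcongr
    _ = _ := by ring

/-- Moments of sums of independent nonnegative variables with Weibull type tails. -/
lemma lintegral_sum_pow_le_of_weibull {n : ℕ} {Y : Fin n → ℝ → ℝ} (hYm : ∀ i, Measurable (Y i))
    (hY0 : ∀ i s, 0 ≤ Y i s) {r : ℝ} (hr : 1 ≤ r) (hYV : ∀ i s, Y i s ≤ ((1 + |s|) ^ 2) ^ r)
    {k : ℕ} (hk : 1 ≤ k) {c D : ℝ} (hc : 0 < c) (hD : 0 ≤ D)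
    (hI : ∑ i, ∫⁻ s, ENNReal.ofReal (Y i s * Real.exp (c * (1 + |s|) ^ 2)) ∂gaussianReal 0 1
      ≤ ENNReal.ofReal (D * (k : ℝ) ^ r)) :
    ∫⁻ x, ENNReal.ofReal ((∑ i, Y i (x i)) ^ k) ∂stdGauss n
      ≤ ENNReal.ofReal (((r / c) ^ r * Real.exp (c + c * D) * (k : ℝ) ^ r) ^ k) := by
  have hk0 : (0:ℝ) < k := by exact_mod_cast hk
  have hr0 : 0 < r := by linarith
  set B : ℝ := ((r / c) ^ r * Real.exp c * (k : ℝ) ^ r) ^ k with hB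
  have hB0 : 0 ≤ B := by positivity
  have hhm : ∀ i, Measurable fun s => truncRoot r k (Y i s) := fun i => by
    unfold truncRoot
    exact (hYm i).mul ((measurable_const.add (hYm i)).pow_const _)
  set a : ℝ := c * (k:ℝ) ^ (1 - r) with ha
  have ha0 : 0 ≤ a := by positivity
  set I : Fin n → ℝ≥0∞ := fun i =>
    ∫⁻ s, ENNReal.ofReal (Y i s * Real.exp (c * (1 + |s|) ^ 2)) ∂gaussianReal 0 1 with hIdef
  have hIfin : ∀ i, I i ≠ ∞ := fun i =>
    ((Finset.single_le_sum (fun _ _ => zero_le) (Finset.mem_univ i)).trans hI).trans_lt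
      ENNReal.ofReal_lt_top |>.ne
  have hone : ∀ i, ∫⁻ s, ENNReal.ofReal (Real.exp (c * truncRoot r k (Y i s))) ∂gaussianReal 0 1
      ≤ ENNReal.ofReal (Real.exp (a * (I i).toReal)) := by
    intro i
    have h1 : ∀ s, ENNReal.ofReal (Real.exp (c * truncRoot r k (Y i s)))
        ≤ 1 + ENNReal.ofReal a * ENNReal.ofReal (Y i s * Real.exp (c * (1 + |s|) ^ 2)) := by
      intro s
      have := hY0 i s
      rw [← ENNReal.ofReal_mul ha0, ← ENNReal.ofReal_one,
        ← ENNReal.ofReal_add zero_le_one (by positivity)]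
      exact ENNReal.ofReal_le_ofReal
        (exp_mul_truncRoot_le hr hk0 hc.le (hY0 i s) (by positivity) (hYV i s))
    refine (lintegral_mono h1).trans ?_
    rw [lintegral_add_left measurable_const, lintegral_const_mul _ (by fun_prop),
      lintegral_one, measure_univ]
    change 1 + ENNReal.ofReal a * I i ≤ _
    rw [← ENNReal.ofReal_toReal (hIfin i), ← ENNReal.ofReal_mul ha0, ← ENNReal.ofReal_one,
      ← ENNReal.ofReal_add zero_le_one (by positivity), ENNReal.toReal_ofReal (by positivity)]
    refine ENNReal.ofReal_le_ofReal ?_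
    linarith [Real.add_one_le_exp (a * (I i).toReal)]
  have hpt : ∀ x : Fin n → ℝ, ENNReal.ofReal ((∑ i, Y i (x i)) ^ k)
      ≤ ENNReal.ofReal B *
        ∏ i, ENNReal.ofReal (Real.exp (c * truncRoot r k (Y i (x i)))) := by
    intro x
    rw [← ENNReal.ofReal_prod_of_nonneg fun _ _ => (Real.exp_pos _).le, ← Real.exp_sum,
      ← ENNReal.ofReal_mul hB0, ← Finset.mul_sum]
    refine ENNReal.ofReal_le_ofReal ?_
    refine (pow_le_mul_exp_truncRoot hr hc hk (Finset.sum_nonneg fun i _ => hY0 i _)).trans ?_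
    gcongr
    exact truncRoot_sum_le _ hr hk0 fun i _ => hY0 i _
  refine (lintegral_mono hpt).trans ?_
  have hpm : ∀ i, Measurable fun s => ENNReal.ofReal (Real.exp (c * truncRoot r k (Y i s))) :=
    fun i => (Real.measurable_exp.comp ((hhm i).const_mul c)).ennreal_ofReal
  have hpm' : Measurable fun x : Fin n → ℝ =>
      ∏ i, ENNReal.ofReal (Real.exp (c * truncRoot r k (Y i (x i)))) :=
    Finset.measurable_prod _ fun i _ => (hpm i).comp (measurable_pi_apply i)
  rw [lintegral_const_mul _ hpm', lintegral_prod_stdGauss _ hpm]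
  have hJ : ∑ i, (I i).toReal ≤ D * (k:ℝ) ^ r := by
    rw [← ENNReal.toReal_sum fun i _ => hIfin i]
    exact ENNReal.toReal_le_of_le_ofReal (by positivity) hI
  have hprod : ∏ i, ∫⁻ s, ENNReal.ofReal (Real.exp (c * truncRoot r k (Y i s))) ∂gaussianReal 0 1
      ≤ ENNReal.ofReal (Real.exp (k * (c * D))) := by
    refine (Finset.prod_le_prod' fun i _ => hone i).trans ?_
    rw [← ENNReal.ofReal_prod_of_nonneg fun _ _ => (Real.exp_pos _).le, ← Real.exp_sum,
      ← Finset.mul_sum]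
    refine ENNReal.ofReal_le_ofReal (Real.exp_le_exp.2 ?_)
    -- The powers k^(1-r) and k^r combine to k, so the product costs only a constant to the power k.
    calc a * ∑ i, (I i).toReal ≤ a * (D * (k:ℝ) ^ r) := by gcongr
      _ = c * D * ((k:ℝ) ^ (1 - r) * (k:ℝ) ^ r) := by rw [ha]; ring
      _ = k * (c * D) := by
        rw [← Real.rpow_add hk0, sub_add_cancel, Real.rpow_one]; ring
  refine (mul_le_mul_right hprod _).trans ?_
  rw [← ENNReal.ofReal_mul hB0]
  refine ENNReal.ofReal_le_ofReal (le_of_eq ?_)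
  rw [hB, Real.exp_nat_mul, ← mul_pow, Real.exp_add]
  congr 1
  ring

lemma lintegral_exp_sq_gaussianReal_lt_top {b : ℝ} (hb : b < 1 / 2) :
    ∫⁻ s, ENNReal.ofReal (Real.exp (b * s ^ 2)) ∂gaussianReal 0 1 < ∞ := by
  rw [gaussianReal_of_var_ne_zero 0 one_ne_zero,
    lintegral_withDensity_eq_lintegral_mul _ (measurable_gaussianPDF 0 1) (by fun_prop)]
  have h := (integrable_exp_neg_mul_sq (b := 1 / 2 - b) (by linarith)).const_mul
    (√(2 * Real.pi * (1 : NNReal)))⁻¹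
  refine lt_of_le_of_lt (lintegral_mono fun s => ?_) h.hasFiniteIntegral
  rw [Pi.mul_apply, gaussianPDF, ← ENNReal.ofReal_mul (gaussianPDFReal_nonneg _ _ _),
    gaussianPDFReal, ← ofReal_norm, mul_assoc, ← Real.exp_add]
  refine ENNReal.ofReal_le_ofReal ((le_abs_self _).trans (le_of_eq ?_))
  rw [Real.norm_eq_abs]
  congr 3
  push_cast
  ring

/-- The power is absorbed at rate 1/16; since (1 + |s|)² ≤ 2 + 2s², the total rate 3/16 becomes 3/8
< 1/2, which the Gaussian density beats. -/
lemma lintegral_weibull_exp_lt_top {r : ℝ} (hr : 0 < r) :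
    ∫⁻ s, ENNReal.ofReal (((1 + |s|) ^ 2) ^ r * Real.exp (1 / 8 * (1 + |s|) ^ 2))
      ∂gaussianReal 0 1 < ∞ := by
  have hpt : ∀ s : ℝ, ENNReal.ofReal (((1 + |s|) ^ 2) ^ r * Real.exp (1 / 8 * (1 + |s|) ^ 2))
      ≤ ENNReal.ofReal ((r / (1 / 16)) ^ r * Real.exp (3 / 8)) *
        ENNReal.ofReal (Real.exp (3 / 8 * s ^ 2)) := by
    intro s
    rw [← ENNReal.ofReal_mul (by positivity)]
    refine ENNReal.ofReal_le_ofReal ?_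
    have h := rpow_le_mul_exp (x := (1 + |s|) ^ 2) (by positivity) hr (by norm_num : (0:ℝ) < 1 / 16)
    calc _ ≤ (r / (1 / 16)) ^ r * Real.exp (1 / 16 * (1 + |s|) ^ 2)
          * Real.exp (1 / 8 * (1 + |s|) ^ 2) := by gcongr
      _ = (r / (1 / 16)) ^ r * Real.exp (3 / 16 * (1 + |s|) ^ 2) := by
        rw [mul_assoc, ← Real.exp_add]; congr 2; ring
      _ ≤ (r / (1 / 16)) ^ r * Real.exp (3 / 8 + 3 / 8 * s ^ 2) := by
        gcongr
        nlinarith [sq_nonneg (1 - |s|), sq_abs s]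
      _ = _ := by rw [Real.exp_add]; ring
  refine (lintegral_mono hpt).trans_lt ?_
  rw [lintegral_const_mul _ (by fun_prop)]
  exact ENNReal.mul_lt_top ENNReal.ofReal_lt_top
    (lintegral_exp_sq_gaussianReal_lt_top (by norm_num))

/-! ### From moments to concentration around medians -/

/-- When the first copy is beyond m by more than s, the independent second copy lies on the other
side of m with probability at least 1/2. The upper and lower cases are disjoint, so only one factor
2 is lost. -/
lemma IsMedian.measure_abs_sub_gt_le {E : Type*} [MeasurableSpace E] {ν : Measure E}
    [IsProbabilityMeasure ν] {Y : E → ℝ} (hY : Measurable Y) {m : ℝ} (hm : IsMedian ν Y m) {s : ℝ}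
    (hs : 0 ≤ s) :
    ν {x | s < |Y x - m|} ≤ 2 * (ν.prod ν) {p | s < |Y p.1 - Y p.2|} := by
  have hA : MeasurableSet {x | m + s < Y x} := measurableSet_lt measurable_const hY
  have hB : MeasurableSet {x | Y x < m - s} := measurableSet_lt hY measurable_const
  have hA' : MeasurableSet {x | Y x ≤ m} := measurableSet_le hY measurable_const
  have hB' : MeasurableSet {x | m ≤ Y x} := measurableSet_le measurable_const hY
  set A := {x | m + s < Y x}
  set B := {x | Y x < m - s}
  set A' := {x | Y x ≤ m}
  set B' := {x | m ≤ Y x}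
  have h1 : ν {x | s < |Y x - m|} ≤ ν A + ν B := by
    refine (measure_mono fun x (hx : s < |Y x - m|) => ?_).trans (measure_union_le A B)
    rcases lt_abs.1 hx with h | h
    · left; change m + s < Y x; linarith
    · right; change Y x < m - s; linarith
  have hdisj : Disjoint (A ×ˢ A') (B ×ˢ B') := by
    refine Set.disjoint_left.2 fun p hp hq => ?_
    have h1 : m + s < Y p.1 := hp.1
    have h2 : Y p.1 < m - s := hq.1
    linarith
  have h2 : ν A * ν A' + ν B * ν B' ≤ (ν.prod ν) {p | s < |Y p.1 - Y p.2|} := by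
    rw [← Measure.prod_prod, ← Measure.prod_prod, ← measure_union hdisj (hB.prod hB')]
    refine measure_mono fun p hp => ?_
    change s < |Y p.1 - Y p.2|
    rcases hp with ⟨h, h'⟩ | ⟨h, h'⟩
    · have h : m + s < Y p.1 := h
      have h' : Y p.2 ≤ m := h'
      exact lt_abs.2 (Or.inl (by linarith))
    · have h : Y p.1 < m - s := h
      have h' : m ≤ Y p.2 := h'
      exact lt_abs.2 (Or.inr (by linarith))
  have h3 : (ν A + ν B) * (1 / 2) ≤ ν A * ν A' + ν B * ν B' := by
    rw [add_mul]
    exact add_le_add (mul_le_mul_right hm.1 _) (mul_le_mul_right hm.2 _)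
  calc ν {x | s < |Y x - m|} ≤ ν A + ν B := h1
    _ = 2 * ((ν A + ν B) * (1 / 2)) := by
      rw [mul_comm, mul_assoc, one_div, ENNReal.inv_mul_cancel two_ne_zero ENNReal.ofNat_ne_top,
        mul_one]
    _ ≤ _ := mul_le_mul_right (h3.trans h2) _

/-- Chebyshev's inequality at order 2k, with 3^(-k) ≤ e^(-k). For s = 0 division is impossible, but
then the moment vanishes and Z = 0 almost everywhere. -/
lemma measure_abs_gt_le_exp_of_lintegral_pow_le {E : Type*} [MeasurableSpace E] {ν : Measure E}
    {Z : E → ℝ} (hZ : Measurable Z) {s : ℝ} (hs : 0 ≤ s) {k : ℕ} (hk : 1 ≤ k)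
    (h : ∫⁻ x, ENNReal.ofReal (Z x ^ (2 * k)) ∂ν ≤ ENNReal.ofReal ((s ^ 2 / 3) ^ k)) :
    ν {x | s < |Z x|} ≤ ENNReal.ofReal (Real.exp (-k)) := by
  rcases hs.eq_or_lt with rfl | hs
  · have h0 : ∫⁻ x, ENNReal.ofReal (Z x ^ (2 * k)) ∂ν = 0 := by
      simpa [show k ≠ 0 by omega] using h
    rw [lintegral_eq_zero_iff (by fun_prop)] at h0
    have h1 : ν {x | 0 < |Z x|} = 0 := by
      have h2 : ∀ᵐ x ∂ν, ¬ (0 < |Z x|) := by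
        filter_upwards [h0] with x hx hpos
        rw [Pi.zero_apply, ENNReal.ofReal_eq_zero, ← (even_two_mul k).pow_abs] at hx
        exact absurd hx (not_le.2 (by positivity))
      simpa [ae_iff] using h2
    rw [h1]
    exact zero_le
  · have hc := mul_meas_ge_le_lintegral (μ := ν) (f := fun x => ENNReal.ofReal (Z x ^ (2 * k)))
      (by fun_prop) (ENNReal.ofReal (s ^ (2 * k)))
    have hsub : ν {x | s < |Z x|}
        ≤ ν {x | ENNReal.ofReal (s ^ (2 * k)) ≤ ENNReal.ofReal (Z x ^ (2 * k))} := by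
      refine measure_mono fun x (hx : s < |Z x|) => ENNReal.ofReal_le_ofReal ?_
      rw [← (even_two_mul k).pow_abs (Z x)]
      exact pow_le_pow_left₀ hs.le hx.le _
    have hpos : 0 < s ^ (2 * k) := by positivity
    have h2 := (mul_le_mul_right hsub (ENNReal.ofReal (s ^ (2 * k)))).trans (hc.trans h)
    have hexp : (1 / 3 : ℝ) ^ k ≤ Real.exp (-k) := by
      rw [Real.exp_neg, ← Real.exp_one_pow, ← inv_pow]
      refine pow_le_pow_left₀ (by norm_num) ?_ k
      rw [one_div]
      exact inv_anti₀ (Real.exp_pos 1) (by linarith [Real.exp_one_lt_d9])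
    have h3 : (s ^ 2 / 3) ^ k ≤ s ^ (2 * k) * Real.exp (-k) := by
      calc (s ^ 2 / 3) ^ k = s ^ (2 * k) * (1 / 3) ^ k := by
            rw [pow_mul, ← mul_pow]; congr 1; ring
        _ ≤ _ := by gcongr
    have h4 := h2.trans (ENNReal.ofReal_le_ofReal h3)
    rw [ENNReal.ofReal_mul hpos.le] at h4
    exact (ENNReal.mul_le_mul_iff_right (ENNReal.ofReal_pos.2 hpos).ne' ENNReal.ofReal_ne_top).1 h4

lemma map_normalQuantile_pi {n : ℕ} (μ : Fin n → Measure ℝ) [∀ i, IsProbabilityMeasure (μ i)] :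
    (stdGauss n).map (fun x i => (quantile (μ i) ∘ stdNormalCDF) (x i)) = Measure.pi μ := by
  have : ∀ i, SigmaFinite ((gaussianReal 0 1).map (quantile (μ i) ∘ stdNormalCDF)) := fun i => by
    rw [map_normalQuantile]; infer_instance
  rw [stdGauss, Measure.pi_map_pi fun i => (measurable_normalQuantile (μ i)).aemeasurable]
  simp_rw [map_normalQuantile]

/-- Any finite bound serves for dominated convergence; the factor `n` does not enter the final
estimates. -/
lemma norm_fderiv_le_of_partialDeriv_le {n : ℕ} {f : (Fin n → ℝ) → ℝ} {L : ℝ} (hL : 0 ≤ L)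
    (h : ∀ x i, |partialDeriv f i x| ≤ L) (x : Fin n → ℝ) : ‖fderiv ℝ f x‖ ≤ n * L := by
  refine ContinuousLinearMap.opNorm_le_bound _ (by positivity) fun v => ?_
  rw [fderiv_apply_eq_sum_partialDeriv]
  refine (norm_sum_le _ _).trans ?_
  have : ∀ i ∈ Finset.univ, ‖partialDeriv f i x * v i‖ ≤ L * ‖v‖ := fun i _ => by
    rw [norm_mul]
    exact mul_le_mul (h x i) (norm_le_pi_norm v i) (norm_nonneg _) hL
  refine (Finset.sum_le_sum this).trans (le_of_eq ?_)
  simp [mul_assoc]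

/-- A moment bound for the transported gradient yields a concentration inequality around
medians. -/
lemma measure_abs_sub_median_gt_le {n : ℕ} {μ : Fin n → Measure ℝ}
    [∀ i, IsProbabilityMeasure (μ i)] {r : ℝ} (hr : 0 ≤ r)
    (hlip : ∀ i s, localLip (quantile (μ i) ∘ stdNormalCDF) s ≤ ENNReal.ofReal ((1 + |s|) ^ r))
    {f : (Fin n → ℝ) → ℝ} (hf : Differentiable ℝ f) {L : ℝ} (hL : 0 ≤ L)
    (hfL : ∀ x i, |partialDeriv f i x| ≤ L)
    {Ω : Type*} [MeasurableSpace Ω] {P : Measure Ω}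
    {X : Fin n → Ω → ℝ} (hX : HasLaw (fun ω i => X i ω) (Measure.pi μ) P)
    {m : ℝ} (hm : IsMedian P (fun ω => f (fun i => X i ω)) m) {s : ℝ} (hs : 0 ≤ s)
    {k : ℕ} (hk : 1 ≤ k)
    (h : ∫⁻ x, ENNReal.ofReal ((96 * k * ∑ i,
        (partialDeriv f i (fun j => (quantile (μ j) ∘ stdNormalCDF) (x j)) *
          deriv (quantile (μ i) ∘ stdNormalCDF) (x i)) ^ 2) ^ k) ∂stdGauss n
      ≤ ENNReal.ofReal ((s ^ 2 / 3) ^ k)) :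
    P {ω | s < |f (fun i => X i ω) - m|} ≤ ENNReal.ofReal (2 * Real.exp (-k)) := by
  set S : (Fin n → ℝ) → Fin n → ℝ := fun x i => (quantile (μ i) ∘ stdNormalCDF) (x i) with hS
  have hSm : Measurable S := measurable_pi_lambda _ fun i =>
    (measurable_normalQuantile (μ i)).comp (measurable_pi_apply i)
  have hfm : Measurable f := hf.continuous.measurable
  have hlaw : ∀ A : Set (Fin n → ℝ), MeasurableSet A →
      P {ω | (fun i => X i ω) ∈ A} = stdGauss n {x | S x ∈ A} := fun A hA => by
    have h1 := Measure.map_apply hSm hA (μ := stdGauss n)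
    rw [map_normalQuantile_pi μ, ← hX.map_eq, Measure.map_apply_of_aemeasurable hX.aemeasurable hA]
      at h1
    exact h1
  have hm' : IsMedian (stdGauss n) (fun x => f (S x)) m :=
    ⟨(hlaw {y | f y ≤ m} (measurableSet_le hfm measurable_const)) ▸ hm.1,
      (hlaw {y | m ≤ f y} (measurableSet_le measurable_const hfm)) ▸ hm.2⟩
  have hgm : Measurable fun x => f (S x) := hfm.comp hSm
  have e := hlaw {y | s < |f y - m|} (measurableSet_lt measurable_const (by fun_prop))
  have hMP := lintegral_sub_pow_comp_le hf (fun i => normalQuantile_monotone (μ i)) hr hlip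
    (norm_fderiv_le_of_partialDeriv_le hL hfL) hk
  have hC := measure_abs_gt_le_exp_of_lintegral_pow_le
    (ν := (stdGauss n).prod (stdGauss n)) (Z := fun p => f (S p.1) - f (S p.2))
    (by fun_prop) hs hk (hMP.trans h)
  calc P {ω | s < |f (fun i => X i ω) - m|} = stdGauss n {x | s < |f (S x) - m|} := e
    _ ≤ 2 * ((stdGauss n).prod (stdGauss n)) {p | s < |f (S p.1) - f (S p.2)|} :=
      hm'.measure_abs_sub_gt_le hgm hs
    _ ≤ 2 * ENNReal.ofReal (Real.exp (-k)) := mul_le_mul_right hC _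
    _ = _ := by rw [ENNReal.ofReal_mul zero_le_two, ENNReal.ofReal_ofNat]

lemma sq_mul_deriv_le_of_localLip_le {T : ℝ → ℝ} {r x : ℝ}
    (h : localLip T x ≤ ENNReal.ofReal ((1 + |x|) ^ r)) (v : ℝ) :
    (v * deriv T x) ^ 2 ≤ v ^ 2 * ((1 + |x|) ^ 2) ^ r := by
  have h1 := abs_deriv_le_of_localLip_le (by positivity) h
  rw [mul_pow]
  refine mul_le_mul_of_nonneg_left ?_ (sq_nonneg v)
  rw [← sq_abs, ← Real.rpow_natCast_mul (by positivity), mul_comm, Real.rpow_mul_natCast (by positivity)]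
  exact pow_le_pow_left₀ (abs_nonneg _) h1 2

/-! ### Moments of the transported gradient -/

/-- The constant in the moment bounds. -/
noncomputable def weibullConst (r : ℝ) : ℝ := (r / (1 / 16)) ^ r *
  Real.exp (1 / 16 + 1 / 16 * (∫⁻ s, ENNReal.ofReal (((1 + |s|) ^ 2) ^ r *
    Real.exp (1 / 8 * (1 + |s|) ^ 2)) ∂gaussianReal 0 1).toReal)

lemma weibullConst_pos {r : ℝ} (hr : 0 < r) : 0 < weibullConst r := by
  unfold weibullConst; positivity

/-- The general moment bound with c = 1/16. The larger rate 1/8 on the right of `hYb` leaves room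
for an exponentially small b_i when Y_i is supported far out. -/
lemma lintegral_sum_pow_le_weibullConst {n : ℕ} {Y : Fin n → ℝ → ℝ} (hYm : ∀ i, Measurable (Y i))
    (hY0 : ∀ i s, 0 ≤ Y i s) {r : ℝ} (hr : 1 ≤ r) (hYV : ∀ i s, Y i s ≤ ((1 + |s|) ^ 2) ^ r)
    {k : ℕ} (hk : 1 ≤ k) {b : Fin n → ℝ} (hb : ∀ i, 0 ≤ b i) (hbk : ∑ i, b i ≤ (k : ℝ) ^ r)
    (hYb : ∀ i s, Y i s * Real.exp (1 / 16 * (1 + |s|) ^ 2)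
      ≤ b i * (((1 + |s|) ^ 2) ^ r * Real.exp (1 / 8 * (1 + |s|) ^ 2))) :
    ∫⁻ x, ENNReal.ofReal ((∑ i, Y i (x i)) ^ k) ∂stdGauss n
      ≤ ENNReal.ofReal ((weibullConst r * (k : ℝ) ^ r) ^ k) := by
  have hfin := lintegral_weibull_exp_lt_top (r := r) (by linarith)
  refine lintegral_sum_pow_le_of_weibull hYm hY0 hr hYV hk (by norm_num) ENNReal.toReal_nonneg ?_
  have h1 : ∀ i, ∫⁻ s, ENNReal.ofReal (Y i s * Real.exp (1 / 16 * (1 + |s|) ^ 2)) ∂gaussianReal 0 1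
      ≤ ENNReal.ofReal (b i) * ∫⁻ s, ENNReal.ofReal (((1 + |s|) ^ 2) ^ r *
        Real.exp (1 / 8 * (1 + |s|) ^ 2)) ∂gaussianReal 0 1 := fun i => by
    rw [← lintegral_const_mul _ (by fun_prop)]
    refine lintegral_mono fun s => ?_
    rw [← ENNReal.ofReal_mul (hb i)]
    exact ENNReal.ofReal_le_ofReal (hYb i s)
  refine (Finset.sum_le_sum fun i _ => h1 i).trans ?_
  rw [← Finset.sum_mul, ← ENNReal.ofReal_sum_of_nonneg fun i _ => hb i, mul_comm,
    ENNReal.ofReal_mul ENNReal.toReal_nonneg, ENNReal.ofReal_toReal hfin.ne]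
  gcongr

lemma lintegral_gradient_pow_le_of_sharp {n : ℕ} {T : Fin n → ℝ → ℝ} {r : ℝ} (hr : 1 ≤ r)
    (hT : ∀ i x, localLip (T i) x ≤ ENNReal.ofReal ((1 + |x|) ^ r))
    {v : Fin n → (Fin n → ℝ) → ℝ} {a : Fin n → ℝ} (hv : ∀ i x, |v i x| ≤ a i) {L : ℝ}
    (haL : ∀ i, a i ≤ L) {k : ℕ} (hk : 1 ≤ k) (ha2 : ∑ i, a i ^ 2 ≤ L ^ 2 * (k : ℝ) ^ r) :
    ∫⁻ x, ENNReal.ofReal ((96 * k * ∑ i, (v i x * deriv (T i) (x i)) ^ 2) ^ k) ∂stdGauss n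
      ≤ ENNReal.ofReal ((96 * k * (L ^ 2 * (weibullConst r * (k : ℝ) ^ r))) ^ k) := by
  have ha0 : ∀ i, 0 ≤ a i := fun i => (abs_nonneg _).trans (hv i 0)
  set Y : Fin n → ℝ → ℝ := fun i s => (a i / L) ^ 2 * ((1 + |s|) ^ 2) ^ r with hY
  have haL2 : ∀ i, a i ^ 2 = L ^ 2 * (a i / L) ^ 2 := fun i => by
    rcases eq_or_ne L 0 with h | h
    · have : a i = 0 := le_antisymm (h ▸ haL i) (ha0 i)
      simp [this]
    · rw [← mul_pow, mul_div_cancel₀ _ h]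
  have hq1 : ∀ i, (a i / L) ^ 2 ≤ 1 := fun i =>
    pow_le_one₀ (div_nonneg (ha0 i) ((ha0 i).trans (haL i)))
      (div_le_one_of_le₀ (haL i) ((ha0 i).trans (haL i)))
  have hpt : ∀ x : Fin n → ℝ,
      ENNReal.ofReal ((96 * k * ∑ i, (v i x * deriv (T i) (x i)) ^ 2) ^ k)
      ≤ ENNReal.ofReal ((96 * k * L ^ 2) ^ k) * ENNReal.ofReal ((∑ i, Y i (x i)) ^ k) := by
    intro x
    rw [← ENNReal.ofReal_mul (by positivity), ← mul_pow]
    refine ENNReal.ofReal_le_ofReal (pow_le_pow_left₀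
      (mul_nonneg (by positivity) (Finset.sum_nonneg fun i _ => sq_nonneg _)) ?_ k)
    rw [mul_assoc (96 * (k:ℝ)), Finset.mul_sum (f := fun i => Y i (x i))]
    refine mul_le_mul_of_nonneg_left (Finset.sum_le_sum fun i _ => ?_) (by positivity)
    refine (sq_mul_deriv_le_of_localLip_le (hT i (x i)) _).trans ?_
    rw [hY]
    simp only
    rw [← mul_assoc, ← haL2, ← sq_abs]
    gcongr
    exact hv i x
  refine (lintegral_mono hpt).trans ?_
  rw [lintegral_const_mul _ (by fun_prop)]
  have hm := lintegral_sum_pow_le_weibullConst (Y := Y) (fun i => by fun_prop)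
    (fun i s => by positivity) hr (fun i s => mul_le_of_le_one_left (by positivity) (hq1 i)) hk
    (b := fun i => (a i / L) ^ 2) (fun i => sq_nonneg _) (by
      rcases eq_or_ne L 0 with h | h
      · simp only [h, div_zero]; simp; positivity
      · simp_rw [haL2, ← Finset.mul_sum] at ha2
        exact le_of_mul_le_mul_left ha2 (by positivity))
    (fun i s => by
      simp only [hY]
      rw [mul_assoc]
      gcongr
      norm_num)
  refine (mul_le_mul_right hm _).trans ?_
  rw [← ENNReal.ofReal_mul (by positivity), ← mul_pow, mul_assoc (96 * (k:ℝ))]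

/-- The Weibull weights are split at (16ℓ)^r. Below the cut, the sum of squares is controlled by
`L₂`; above it, each derivative is bounded by `L`, and the n excesses have total mass of order n
e^(-ℓ), which `hnℓ` makes affordable. -/
lemma lintegral_gradient_pow_le {n : ℕ} {T : Fin n → ℝ → ℝ} {r : ℝ} (hr : 1 ≤ r)
    (hT : ∀ i x, localLip (T i) x ≤ ENNReal.ofReal ((1 + |x|) ^ r))
    {v : Fin n → (Fin n → ℝ) → ℝ} {L₂ L : ℝ} (hv2 : ∀ x, ∑ i, v i x ^ 2 ≤ L₂ ^ 2)
    (hv : ∀ i x, |v i x| ≤ L) {k : ℕ} (hk : 1 ≤ k) {ℓ : ℝ} (hℓ : 0 ≤ ℓ)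
    (hnℓ : n * Real.exp (-ℓ) ≤ (k : ℝ) ^ r) :
    ∫⁻ x, ENNReal.ofReal ((96 * k * ∑ i, (v i x * deriv (T i) (x i)) ^ 2) ^ k) ∂stdGauss n
      ≤ ENNReal.ofReal
        ((192 * k * ((16 * ℓ) ^ r * L₂ ^ 2 + L ^ 2 * (weibullConst r * (k : ℝ) ^ r))) ^ k) := by
  have hr0 : 0 < r := by linarith
  have hW := weibullConst_pos hr0
  set A := (16 * ℓ) ^ r with hA
  have hA0 : 0 ≤ A := by positivity
  set Y : Fin n → ℝ → ℝ := fun _ s => max (((1 + |s|) ^ 2) ^ r - A) 0 with hY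
  have hY0 : ∀ i s, 0 ≤ Y i s := fun i s => le_max_right _ _
  have hpt : ∀ x : Fin n → ℝ,
      ENNReal.ofReal ((96 * k * ∑ i, (v i x * deriv (T i) (x i)) ^ 2) ^ k)
      ≤ ENNReal.ofReal ((192 * k * (A * L₂ ^ 2)) ^ k) +
        ENNReal.ofReal ((192 * k * L ^ 2) ^ k) * ENNReal.ofReal ((∑ i, Y i (x i)) ^ k) := by
    intro x
    have hs0 : 0 ≤ ∑ i, Y i (x i) := Finset.sum_nonneg fun i _ => hY0 i _
    rw [← ENNReal.ofReal_mul (by positivity), ← mul_pow,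
      ← ENNReal.ofReal_add (by positivity) (by positivity)]
    refine ENNReal.ofReal_le_ofReal ?_
    have h1 : ∑ i, (v i x * deriv (T i) (x i)) ^ 2 ≤ A * L₂ ^ 2 + L ^ 2 * ∑ i, Y i (x i) := by
      calc ∑ i, (v i x * deriv (T i) (x i)) ^ 2
          ≤ ∑ i, (A * v i x ^ 2 + L ^ 2 * Y i (x i)) := by
            refine Finset.sum_le_sum fun i _ => ?_
            refine (sq_mul_deriv_le_of_localLip_le (hT i (x i)) _).trans ?_
            have h2 : ((1 + |x i|) ^ 2) ^ r ≤ A + Y i (x i) := by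
              have := le_max_left (((1 + |x i|) ^ 2) ^ r - A) 0
              simp only [hY]; linarith
            have h3 : v i x ^ 2 ≤ L ^ 2 := by
              rw [← sq_abs]; exact pow_le_pow_left₀ (abs_nonneg _) (hv i x) 2
            nlinarith [mul_le_mul_of_nonneg_left h2 (sq_nonneg (v i x)),
              mul_le_mul_of_nonneg_right h3 (hY0 i (x i))]
        _ = A * ∑ i, v i x ^ 2 + L ^ 2 * ∑ i, Y i (x i) := by
            rw [Finset.sum_add_distrib, Finset.mul_sum, Finset.mul_sum]
        _ ≤ _ := by gcongr; exact hv2 x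
    have h4 := add_pow_le (a := 96 * k * (A * L₂ ^ 2)) (b := 96 * k * (L ^ 2 * ∑ i, Y i (x i)))
      (by positivity) (by positivity) k
    have h5 : (2:ℝ) ^ (k - 1) ≤ 2 ^ k := pow_le_pow_right₀ (by norm_num) (Nat.sub_le k 1)
    calc (96 * k * ∑ i, (v i x * deriv (T i) (x i)) ^ 2) ^ k
        ≤ (96 * k * (A * L₂ ^ 2) + 96 * k * (L ^ 2 * ∑ i, Y i (x i))) ^ k := by
          refine pow_le_pow_left₀
            (mul_nonneg (by positivity) (Finset.sum_nonneg fun i _ => sq_nonneg _)) ?_ k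
          rw [← mul_add]
          gcongr
      _ ≤ 2 ^ (k - 1) * ((96 * k * (A * L₂ ^ 2)) ^ k + (96 * k * (L ^ 2 * ∑ i, Y i (x i))) ^ k) := h4
      _ ≤ 2 ^ k * ((96 * k * (A * L₂ ^ 2)) ^ k + (96 * k * (L ^ 2 * ∑ i, Y i (x i))) ^ k) := by
          gcongr
      _ = _ := by
          rw [mul_add, ← mul_pow, ← mul_pow]
          congr 2 <;> ring
  refine (lintegral_mono hpt).trans ?_
  have hYm : ∀ i, Measurable (Y i) := fun i => by fun_prop
  rw [lintegral_add_left measurable_const, lintegral_const, measure_univ, mul_one,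
    lintegral_const_mul _ (by fun_prop)]
  have hm := lintegral_sum_pow_le_weibullConst (Y := Y) hYm hY0 hr
    (fun i s => max_le (by linarith) (by positivity)) hk (b := fun _ => Real.exp (-ℓ))
    (fun _ => (Real.exp_pos _).le) (by simpa using hnℓ) (fun i s => by
      rcases le_or_gt (((1 + |s|) ^ 2) ^ r) A with h | h
      · simp only [hY]
        rw [max_eq_right (by linarith), zero_mul]
        positivity
      -- Above the cut, raising the exponential rate from 1/16 to 1/8 gains at least e^ℓ, which pays
      -- for b_i = e^(-ℓ).
      · have h1 : 16 * ℓ < (1 + |s|) ^ 2 := (Real.rpow_lt_rpow_iff (by positivity) (by positivity) hr0).1 h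
        simp only [hY]
        rw [max_eq_left (by linarith), mul_left_comm, ← Real.exp_add]
        gcongr
        · linarith
        · linarith)
  refine (add_le_add_right (mul_le_mul_right hm _) _).trans ?_
  rw [← ENNReal.ofReal_mul (by positivity), ← mul_pow,
    ← ENNReal.ofReal_add (by positivity) (by positivity), mul_add]
  refine ENNReal.ofReal_le_ofReal ?_
  rw [mul_assoc (192 * (k:ℝ)) (L ^ 2)]
  exact pow_add_pow_le (by positivity) (by positivity) (by omega)

/-! ### Real bounds from extended Lipschitz constants -/

lemma le_of_ellNorm_top_le {n : ℕ} {a : Fin n → ℝ≥0∞} {L : ℝ≥0∞} (h : ellNorm ∞ a ≤ L) (i : Fin n) :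
    a i ≤ L := by
  rw [ellNorm, if_pos rfl] at h
  exact (le_iSup a i).trans h

lemma sum_sq_le_of_ellNorm_two_le {n : ℕ} {a : Fin n → ℝ≥0∞} {L : ℝ} (hL : 0 ≤ L)
    (h : ellNorm 2 a ≤ ENNReal.ofReal L) :
    (∀ i, a i ≠ ∞) ∧ ∑ i, (a i).toReal ^ 2 ≤ L ^ 2 := by
  rw [ellNorm, if_neg ENNReal.ofNat_ne_top, ENNReal.toReal_ofNat, one_div,
    ENNReal.rpow_inv_le_iff two_pos] at h
  simp only [ENNReal.rpow_ofNat] at h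
  rw [← ENNReal.ofReal_pow hL] at h
  have hfin : ∀ i, a i ^ 2 ≠ ∞ := fun i =>
    (((Finset.single_le_sum (f := fun i => a i ^ 2) (fun _ _ => zero_le)
      (Finset.mem_univ i)).trans h).trans_lt ENNReal.ofReal_lt_top).ne
  refine ⟨fun i hi => hfin i (by simp [hi]), ?_⟩
  have h2 := ENNReal.toReal_le_of_le_ofReal (by positivity) h
  rw [ENNReal.toReal_sum fun i _ => hfin i] at h2
  simpa using h2

lemma abs_partialDeriv_le_of_gradLip_top_le {n : ℕ} {f : (Fin n → ℝ) → ℝ} {L : ℝ} (hL : 0 ≤ L)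
    (h : gradLip ∞ f ≤ ENNReal.ofReal L) (x : Fin n → ℝ) (i : Fin n) :
    |partialDeriv f i x| ≤ L :=
  (ENNReal.ofReal_le_ofReal_iff hL).1 (le_of_ellNorm_top_le ((le_iSup (fun x =>
    ellNorm ∞ (fun i => ENNReal.ofReal |partialDeriv f i x|)) x).trans h) i)

lemma sum_partialDeriv_sq_le_of_gradLip_two_le {n : ℕ} {f : (Fin n → ℝ) → ℝ} {L : ℝ} (hL : 0 ≤ L)
    (h : gradLip 2 f ≤ ENNReal.ofReal L) (x : Fin n → ℝ) :
    ∑ i, partialDeriv f i x ^ 2 ≤ L ^ 2 := by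
  have := (sum_sq_le_of_ellNorm_two_le hL ((le_iSup (fun x =>
    ellNorm 2 (fun i => ENNReal.ofReal |partialDeriv f i x|)) x).trans h)).2
  simpa [ENNReal.toReal_ofReal (abs_nonneg _)] using this

lemma exists_partialDeriv_bounds_of_gradLipSharp_le {n : ℕ} {f : (Fin n → ℝ) → ℝ} {L₂ L : ℝ}
    (hL₂ : 0 ≤ L₂) (hL : 0 ≤ L) (h2 : gradLipSharp 2 f ≤ ENNReal.ofReal L₂)
    (h : gradLipSharp ∞ f ≤ ENNReal.ofReal L) :
    ∃ a : Fin n → ℝ, (∀ i x, |partialDeriv f i x| ≤ a i) ∧ (∀ i, a i ≤ L) ∧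
      ∑ i, a i ^ 2 ≤ L₂ ^ 2 := by
  obtain ⟨hfin, hsum⟩ := sum_sq_le_of_ellNorm_two_le hL₂ h2
  refine ⟨_, fun i x => ?_, fun i => ENNReal.toReal_le_of_le_ofReal hL (le_of_ellNorm_top_le h i),
    hsum⟩
  exact (ENNReal.ofReal_le_iff_le_toReal (hfin i)).1
    (le_iSup (fun x => ENNReal.ofReal |partialDeriv f i x|) x)

lemma le_of_natCast_le_mul_div_rpow {k : ℕ} (hk : 1 ≤ k) {c t p : ℝ} (hc : 0 < c) (ht : 0 < t)
    (hp : 0 < p) {x : ℝ≥0∞}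
    (h : (k : ℝ≥0∞) ≤ ENNReal.ofReal c * (ENNReal.ofReal t / x) ^ p) :
    x ≤ ENNReal.ofReal (t * (c / k) ^ (1 / p)) := by
  have hk0 : (0:ℝ) < k := by exact_mod_cast hk
  rcases eq_or_ne x ∞ with rfl | hx
  · rw [ENNReal.div_top, ENNReal.zero_rpow_of_pos hp, mul_zero, nonpos_iff_eq_zero,
      Nat.cast_eq_zero] at h
    omega
  rcases eq_or_ne x 0 with rfl | hx0
  · exact zero_le
  lift x to NNReal using hx
  have hx0' : (0:ℝ) < x := by
    have : x ≠ 0 := by simpa using hx0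
    exact NNReal.coe_pos.2 (pos_iff_ne_zero.2 this)
  rw [← ENNReal.ofReal_coe_nnreal, ← ENNReal.ofReal_div_of_pos hx0',
    ENNReal.ofReal_rpow_of_pos (by positivity), ← ENNReal.ofReal_mul hc.le,
    ← ENNReal.ofReal_natCast, ENNReal.ofReal_le_ofReal_iff (by positivity)] at h
  rw [← ENNReal.ofReal_coe_nnreal]
  refine ENNReal.ofReal_le_ofReal ?_
  have h1 : (k / c) ≤ (t / x) ^ p := by rw [div_le_iff₀ hc]; linarith
  have h2 : (k / c) ^ (1 / p) ≤ t / x := by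
    calc (k / c) ^ (1 / p) ≤ ((t / x) ^ p) ^ (1 / p) := by gcongr
      _ = t / x := by rw [← Real.rpow_mul (by positivity), mul_one_div_cancel hp.ne', Real.rpow_one]
  have h3 : (c / k) ^ (1 / p) = ((k / c) ^ (1 / p))⁻¹ := by
    rw [← Real.inv_rpow (by positivity), inv_div]
  rw [h3, ← div_eq_mul_inv, le_div_iff₀ (by positivity)]
  rw [le_div_iff₀ hx0'] at h2
  linarith

/-- Take k = ⌊c u⌋, which is at least c u / 2 once c u ≥ 1. For c u < 1 the bound exceeds 1, and for
u = ∞ one lets k tend to infinity. -/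
lemma le_two_mul_exp_neg_of_forall_nat {c : ℝ} (hc : 0 < c) {u p : ℝ≥0∞} (hp : p ≤ 1)
    (h : ∀ k : ℕ, 1 ≤ k → (k : ℝ≥0∞) ≤ ENNReal.ofReal c * u →
      p ≤ ENNReal.ofReal (2 * Real.exp (-k))) :
    p ≤ 2 * EReal.exp (-((ENNReal.ofReal (c / 2) * u : ℝ≥0∞) : EReal)) := by
  have hc0 : ENNReal.ofReal c ≠ 0 := (ENNReal.ofReal_pos.2 hc).ne'
  rcases eq_or_ne u ∞ with rfl | hu
  · have h0 : p ≤ 0 := by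
      have hlim : Tendsto (fun k : ℕ => ENNReal.ofReal (2 * Real.exp (-k))) atTop (𝓝 0) := by
        have h1 : Tendsto (fun k : ℕ => 2 * Real.exp (-(k:ℝ))) atTop (𝓝 (2 * 0)) :=
          (Real.tendsto_exp_neg_atTop_nhds_zero.comp tendsto_natCast_atTop_atTop).const_mul 2
        rw [mul_zero] at h1
        rw [← ENNReal.ofReal_zero]
        exact (ENNReal.continuous_ofReal.tendsto _).comp h1
      refine ge_of_tendsto hlim ?_
      filter_upwards [eventually_ge_atTop 1] with k hk
      exact h k hk (by rw [ENNReal.mul_top hc0]; exact le_top)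
    exact h0.trans zero_le
  lift u to NNReal using hu
  have e : (ENNReal.ofReal (c / 2) * u : ℝ≥0∞) = ENNReal.ofReal (c / 2 * u) := by
    rw [ENNReal.ofReal_mul (by positivity), ENNReal.ofReal_coe_nnreal]
  have e2 : EReal.exp (-((ENNReal.ofReal (c / 2 * u) : ℝ≥0∞) : EReal))
      = ENNReal.ofReal (Real.exp (-(c / 2 * u))) := by
    rw [EReal.coe_ennreal_ofReal, max_eq_left (by positivity), ← EReal.coe_neg, EReal.exp_coe]
  rw [e, e2, ← ENNReal.ofReal_ofNat, ← ENNReal.ofReal_mul (by norm_num)]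
  rcases lt_or_ge (c * u) 1 with h1 | h1
  · refine hp.trans (ENNReal.one_le_ofReal.2 ?_)
    linarith [Real.add_one_le_exp (-(c / 2 * u))]
  · have hfl : 1 ≤ ⌊c * (u:ℝ)⌋₊ := by rwa [Nat.one_le_floor_iff]
    refine (h ⌊c * (u:ℝ)⌋₊ hfl ?_).trans (ENNReal.ofReal_le_ofReal ?_)
    · rw [← ENNReal.ofReal_natCast, ← ENNReal.ofReal_coe_nnreal, ← ENNReal.ofReal_mul hc.le]
      exact ENNReal.ofReal_le_ofReal (Nat.floor_le (by positivity))
    · have h2 := Nat.lt_floor_add_one (c * (u:ℝ))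
      have h3 : (1:ℝ) ≤ ⌊c * (u:ℝ)⌋₊ := by exact_mod_cast hfl
      gcongr
      linarith

/-! ### The two tail bounds -/

theorem mainTheorem1 (q : ℝ) (hq0 : 0 < q) (hq1 : q < 1) :
    ∃ c C : ℝ, 0 < c ∧ 0 < C ∧
      ∀ (n : ℕ) (_hn : 1 ≤ n)
        (μ : Fin n → Measure ℝ) (_hμ : ∀ i, IsProbabilityMeasure (μ i))
        (_hlip : ∀ (i : Fin n) (s : ℝ),
          localLip (quantile (μ i) ∘ stdNormalCDF) s
            ≤ ENNReal.ofReal ((1 + |s|) ^ (-1 + 2 / q)))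
        (f : (Fin n → ℝ) → ℝ) (_hf : Differentiable ℝ f)
        (Ω : Type*) (_ : MeasurableSpace Ω) (P : Measure Ω) (_hP : IsProbabilityMeasure P)
        (X : Fin n → Ω → ℝ) (_hindep : iIndepFun X P) (_hlaw : ∀ i, HasLaw (X i) (μ i) P)
        (m : ℝ) (_hm : IsMedian P (fun ω => f (fun i => X i ω)) m)
        (t : ℝ) (_ht : 0 < t),
        P {ω | t < |f (fun i => X i ω) - m|}
          ≤ 2 * EReal.exp (-((ENNReal.ofReal c *
              min ((ENNReal.ofReal t / gradLipSharp 2 f) ^ (2 : ℝ))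
                ((ENNReal.ofReal t / gradLipSharp ∞ f) ^ q) : ℝ≥0∞) : EReal))
        ∧
        P {ω | ENNReal.ofReal
                (C * Real.log (Real.exp 1 + n / t ^ (-2 + 4 / q)) ^ (1 / q - 1 / 2))
              * (ENNReal.ofReal t * gradLip 2 f + ENNReal.ofReal (t ^ (2 / q)) * gradLip ∞ f)
              < ENNReal.ofReal |f (fun i => X i ω) - m|}
          ≤ ENNReal.ofReal (2 * Real.exp (-t ^ 2 / 2)) := by
  set r : ℝ := -1 + 2 / q with hr
  have h2q : 2 ≤ 2 / q := by rw [le_div_iff₀ hq0]; linarith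
  have hr1 : 1 ≤ r := by linarith
  have hr0 : 0 < r := by linarith
  set K := weibullConst r with hK
  have hK0 : 0 < K := weibullConst_pos hr0
  -- Ensures 96 K c ≤ 1/3, the threshold required by Chebyshev, together with c ≤ 1.
  set c : ℝ := 1 / (288 * K + 1) with hc
  have hc0 : 0 < c := by positivity
  have hc1 : c ≤ 1 := by rw [hc, div_le_one (by positivity)]; linarith
  have hcK : 96 * K * c ≤ 1 / 3 := by
    rw [hc, mul_one_div, div_le_iff₀ (by positivity)]; linarith
  -- 1152 = 3 · 192 · 2: Chebyshev's 1/3, the constant of the moment bound, and k ≤ 2t².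
  set B : ℝ := 1152 * (16 ^ r + 2 ^ r * K) with hB
  have hB0 : 0 < B := by positivity
  refine ⟨c / 2, √B, by positivity, by positivity, ?_⟩
  intro n _ μ _ hlip f hf Ω _ P _ X hindep hlaw m hm t ht
  have hX : HasLaw (fun ω i => X i ω) (Measure.pi μ) P := hindep.hasLaw_pi hlaw
  constructor
  · refine le_two_mul_exp_neg_of_forall_nat hc0 prob_le_one fun k hk hku => ?_
    have hk0 : (0:ℝ) < k := by exact_mod_cast hk
    have h2 := le_of_natCast_le_mul_div_rpow hk hc0 ht two_pos
      (hku.trans (mul_le_mul_right (min_le_left _ _) _))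
    have hi := le_of_natCast_le_mul_div_rpow hk hc0 ht hq0
      (hku.trans (mul_le_mul_right (min_le_right _ _) _))
    -- Enlarging c^(1/q) to √c makes L² k^r equal to t² c / k, exactly the bound available for the
    -- sum of the a_i².
    set L : ℝ := t * (√c * (1 / k) ^ (1 / q)) with hL
    have hL0 : 0 ≤ L := by positivity
    have hiL : gradLipSharp ∞ f ≤ ENNReal.ofReal L := by
      refine hi.trans (ENNReal.ofReal_le_ofReal ?_)
      rw [hL, div_eq_mul_one_div c, Real.mul_rpow hc0.le (by positivity), Real.sqrt_eq_rpow]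
      have : c ^ (1 / q) ≤ c ^ (1 / 2 : ℝ) :=
        Real.rpow_le_rpow_of_exponent_ge hc0 hc1 (one_div_le_one_div_of_le hq0 (by linarith))
      gcongr
    obtain ⟨a, ha, haL, ha2⟩ := exists_partialDeriv_bounds_of_gradLipSharp_le
      (by positivity) hL0 h2 hiL
    have hkq : ((1 / k : ℝ) ^ (1 / q)) ^ 2 * (k:ℝ) ^ r = 1 / k := by
      rw [one_div, Real.inv_rpow hk0.le, ← Real.rpow_neg hk0.le, ← Real.rpow_mul_natCast hk0.le,
        ← Real.rpow_add hk0, ← Real.rpow_neg_one]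
      congr 1
      rw [hr]; push_cast; ring
    have hLk : L ^ 2 * (k:ℝ) ^ r = t ^ 2 * (c / k) := by
      rw [hL, mul_pow, mul_pow, Real.sq_sqrt hc0.le, mul_assoc, mul_assoc, hkq]; ring
    have hbd : ∑ i, a i ^ 2 ≤ L ^ 2 * (k:ℝ) ^ r := by
      rw [hLk]
      refine ha2.trans (le_of_eq ?_)
      rw [mul_pow, ← Real.sqrt_eq_rpow, Real.sq_sqrt (by positivity)]
    refine measure_abs_sub_median_gt_le hr0.le hlip hf hL0 (fun x i => (ha i x).trans (haL i)) hX hm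
      ht.le hk ?_
    refine (lintegral_gradient_pow_le_of_sharp hr1 hlip
      (v := fun i x => partialDeriv f i (fun j => (quantile (μ j) ∘ stdNormalCDF) (x j)))
      (fun i x => ha i _) haL hk hbd).trans (ENNReal.ofReal_le_ofReal ?_)
    refine pow_le_pow_left₀ (by positivity) ?_ k
    calc 96 * k * (L ^ 2 * (K * (k:ℝ) ^ r)) = 96 * k * K * (L ^ 2 * (k:ℝ) ^ r) := by ring
      _ = 96 * K * c * t ^ 2 := by rw [hLk]; field_simp
      _ ≤ 1 / 3 * t ^ 2 := by gcongr
      _ = t ^ 2 / 3 := by ring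
  · rcases le_or_gt t 1 with ht1 | ht1
    · refine prob_le_one.trans (ENNReal.one_le_ofReal.2 ?_)
      nlinarith [Real.add_one_le_exp (-t ^ 2 / 2)]
    have hrq : 1 / q - 1 / 2 = r / 2 := by rw [hr]; ring
    have htr : t ^ (-2 + 4 / q) = (t ^ r) ^ 2 := by
      rw [← Real.rpow_mul_natCast ht.le, hr]
      congr 1
      push_cast; ring
    rw [hrq, htr]
    set ℓ := Real.log (Real.exp 1 + n / (t ^ r) ^ 2) with hℓ
    have hpos : 0 < Real.exp 1 + n / (t ^ r) ^ 2 := by positivity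
    have hℓ1 : 1 ≤ ℓ := by
      rw [hℓ, Real.le_log_iff_exp_le hpos]
      have : 0 ≤ n / (t ^ r) ^ 2 := by positivity
      linarith
    have hℓ0 : 0 < ℓ := by linarith
    have hcoef : 0 < √B * ℓ ^ (r / 2) := by positivity
    -- An infinite Lipschitz constant makes the threshold infinite and the event empty.
    rcases eq_or_ne (gradLip 2 f) ∞ with h2 | h2
    · have : ENNReal.ofReal (√B * ℓ ^ (r / 2)) * (ENNReal.ofReal t * gradLip 2 f +
          ENNReal.ofReal (t ^ (2 / q)) * gradLip ∞ f) = ∞ := by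
        rw [h2, ENNReal.mul_top (ENNReal.ofReal_pos.2 ht).ne', top_add,
          ENNReal.mul_top (ENNReal.ofReal_pos.2 hcoef).ne']
      rw [this]
      simp
    rcases eq_or_ne (gradLip ∞ f) ∞ with hi | hi
    · have : ENNReal.ofReal (√B * ℓ ^ (r / 2)) * (ENNReal.ofReal t * gradLip 2 f +
          ENNReal.ofReal (t ^ (2 / q)) * gradLip ∞ f) = ∞ := by
        rw [hi, ENNReal.mul_top (ENNReal.ofReal_pos.2 (by positivity)).ne', add_top,
          ENNReal.mul_top (ENNReal.ofReal_pos.2 hcoef).ne']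
      rw [this]
      simp
    set L₂ := (gradLip 2 f).toReal with hL₂
    set L := (gradLip ∞ f).toReal with hL
    have hL₂0 : 0 ≤ L₂ := ENNReal.toReal_nonneg
    have hL0 : 0 ≤ L := ENNReal.toReal_nonneg
    have e2 : gradLip 2 f = ENNReal.ofReal L₂ := (ENNReal.ofReal_toReal h2).symm
    have ei : gradLip ∞ f = ENNReal.ofReal L := (ENNReal.ofReal_toReal hi).symm
    rw [e2, ei, ← ENNReal.ofReal_mul ht.le, ← ENNReal.ofReal_mul (by positivity),
      ← ENNReal.ofReal_add (by positivity) (by positivity), ← ENNReal.ofReal_mul hcoef.le]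
    set s := √B * ℓ ^ (r / 2) * (t * L₂ + t ^ (2 / q) * L) with hs
    have hs0 : 0 ≤ s := by positivity
    have hset : {ω | ENNReal.ofReal s < ENNReal.ofReal |f (fun i => X i ω) - m|}
        ⊆ {ω | s < |f (fun i => X i ω) - m|} := fun ω hω => (ENNReal.ofReal_lt_ofReal_iff_of_nonneg hs0).1 hω
    refine (measure_mono hset).trans ?_
    -- Rounding up gives e^(-k) ≤ e^(-t²/2), and t > 1 keeps k ≤ 2t².
    set k : ℕ := ⌈t ^ 2⌉₊ with hk
    have hkt : t ^ 2 ≤ k := Nat.le_ceil _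
    have ht2 : 1 ≤ t ^ 2 := by nlinarith
    have hk1 : 1 ≤ k := by
      have : (1:ℝ) ≤ k := ht2.trans hkt
      exact_mod_cast this
    have hk2 : (k:ℝ) ≤ 2 * t ^ 2 := by
      have := Nat.ceil_lt_add_one (by positivity : 0 ≤ t ^ 2)
      rw [← hk] at this
      linarith
    have htr2 : (t ^ r) ^ 2 = (t ^ 2) ^ r := by
      rw [← Real.rpow_mul_natCast ht.le, mul_comm, Real.rpow_natCast_mul ht.le]
    -- The logarithm in the statement is designed for this: e^ℓ ≥ n / t^(2r) and t^(2r) ≤ k^r.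
    have hnℓ : n * Real.exp (-ℓ) ≤ (k:ℝ) ^ r := by
      rw [Real.exp_neg, hℓ, Real.exp_log hpos, ← div_eq_mul_inv, div_le_iff₀ hpos]
      have h1 : (t ^ r) ^ 2 ≤ (k:ℝ) ^ r := by
        rw [htr2]; exact Real.rpow_le_rpow (by positivity) hkt hr0.le
      have h3 : 0 ≤ (k:ℝ) ^ r * Real.exp 1 := by positivity
      calc (n:ℝ) = (t ^ r) ^ 2 * (n / (t ^ r) ^ 2) := by field_simp
        _ ≤ (k:ℝ) ^ r * (n / (t ^ r) ^ 2) := by gcongr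
        _ ≤ _ := by rw [mul_add]; linarith
    have hfL := abs_partialDeriv_le_of_gradLip_top_le hL0 ei.le
    have hfL2 := sum_partialDeriv_sq_le_of_gradLip_two_le hL₂0 e2.le
    refine (measure_abs_sub_median_gt_le hr0.le hlip hf hL0 hfL hX hm hs0 hk1 ?_).trans ?_
    · refine (lintegral_gradient_pow_le hr1 hlip
        (v := fun i x => partialDeriv f i (fun j => (quantile (μ j) ∘ stdNormalCDF) (x j)))
        (fun x => hfL2 _) (fun i x => hfL _ i) hk1 hℓ0.le hnℓ).trans (ENNReal.ofReal_le_ofReal ?_)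
      refine pow_le_pow_left₀ (by positivity) ?_ k
      have hkr : (k:ℝ) ^ r ≤ 2 ^ r * (t ^ r) ^ 2 := by
        rw [htr2, ← Real.mul_rpow zero_le_two (by positivity)]
        exact Real.rpow_le_rpow (by positivity) hk2 hr0.le
      have hℓr : 1 ≤ ℓ ^ r := Real.one_le_rpow hℓ1 hr0.le
      have hℓ2 : (ℓ ^ (r / 2)) ^ 2 = ℓ ^ r := by
        rw [← Real.rpow_mul_natCast hℓ0.le]
        congr 1
        push_cast; ring
      have htq : t ^ (2 / q) = t * t ^ r := by
        rw [← Real.rpow_one_add' ht.le (by linarith)]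
        congr 1
        rw [hr]; ring
      have hs2 : s ^ 2 = B * ℓ ^ r * (t * L₂ + t * t ^ r * L) ^ 2 := by
        rw [hs, mul_pow, mul_pow, Real.sq_sqrt hB0.le, hℓ2, htq]
      rw [Real.mul_rpow (by norm_num) hℓ0.le, hs2]
      calc 192 * k * (16 ^ r * ℓ ^ r * L₂ ^ 2 + L ^ 2 * (K * (k:ℝ) ^ r))
          ≤ 192 * (2 * t ^ 2) *
            (16 ^ r * ℓ ^ r * L₂ ^ 2 + L ^ 2 * (K * (2 ^ r * (t ^ r) ^ 2 * ℓ ^ r))) := by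
            have h5 : (k:ℝ) ^ r ≤ 2 ^ r * (t ^ r) ^ 2 * ℓ ^ r :=
              hkr.trans (le_mul_of_one_le_right (by positivity) hℓr)
            gcongr
        _ = 384 * ℓ ^ r * (16 ^ r * (t * L₂) ^ 2 + 2 ^ r * K * (t * t ^ r * L) ^ 2) := by ring
        _ ≤ 384 * ℓ ^ r * ((16 ^ r + 2 ^ r * K) * (t * L₂ + t * t ^ r * L) ^ 2) := by
            have hx : 0 ≤ t * L₂ := by positivity
            have hy : 0 ≤ t * t ^ r * L := by positivity
            have h6 : (t * L₂) ^ 2 ≤ (t * L₂ + t * t ^ r * L) ^ 2 :=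
              pow_le_pow_left₀ hx (by linarith) 2
            have h7 : (t * t ^ r * L) ^ 2 ≤ (t * L₂ + t * t ^ r * L) ^ 2 :=
              pow_le_pow_left₀ hy (by linarith) 2
            rw [add_mul]
            gcongr
        _ = _ := by rw [hB]; ring
    · refine ENNReal.ofReal_le_ofReal ?_
      gcongr
      linarith
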